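/- Let $k$ be a field of characteristic $0$ (for instance $k=\mathbb{C}$) and let $X$ be a smooth projective variety over $k$ (an integral scheme, smooth over $k$, with a closed immersion over $k$ into some $\mathbb{P}^n_k$). Let $\mathcal{L}\xrightarrow{\omega}\Omega^1_X$ be a foliation of codimension $1$ on $X$: that is, $\dim X\ge 2$, $\mathcal{L}$ is a line bundle, $\omega$ is a nonzero morphism of $\mathcal{O}_X$-modules, $\Omega^1_X/\mathcal{L}$ is torsion free, and $\omega(s)\wedge d\omega(s)=0$ for every local section $s$ of $\mathcal{L}$. Let $\mathcal{J}(\omega)\subseteq\mathcal{O}_X$ be the image of the contraction morphism $TX\otimes\mathcal{L}\to\mathcal{O}_X$, $v\otimes s\mapsto i_v\omega(s)$, and let $\mathrm{Sing}(\omega)$ be the closed subscheme it defines. Let $\mathcal{H}^2(\omega)$ be the second cohomology sheaf of the Koszul complex $\mathcal{O}_X\xrightarrow{\wedge\omega}\Omega^1_X\otimes\mathcal{L}^{-1}\xrightarrow{\wedge\omega}\Omega^2_X\otimes\mathcal{L}^{-2}\to\cdots$. The subscheme of persistent singularities $\mathrm{Per}(\omega)\subseteq X$ is defined by the ideal sheaf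 $\mathcal{I}(\omega)=\mathrm{ann}([d\omega])$, where $[d\omega]\in H^0(X,\mathcal{H}^2(\omega)\otimes\mathcal{L})$ is the section induced by $s\mapsto d(\omega(s))$; locally, if $\varpi$ is the image under $\omega$ of a generator of $\mathcal{L}$, then $\mathcal{I}(\omega)=\{h : h\,d\varpi=\varpi\wedge\eta \text{ for some local } 1\text{-form } \eta\}$. The Kupka subscheme $\mathrm{Kup}(\omega)\subseteq X$ is defined by the ideal sheaf $\mathcal{K}(\omega)=\mathrm{ann}(\{d\omega\})$, where $\{d\omega\}$ is the section of $\Omega^2_X\otimes\mathcal{O}_{\mathrm{Sing}(\omega)}\otimes\mathcal{L}^{-1}$ induced by $s\mapsto d(\omega(s))$; locally, $\mathcal{K}(\omega)=\{h : h\,d\varpi\in\mathcal{J}(\omega)\,\Omega^2_X\}$. If $\mathcal{J}(\omega)$ is a sheaf of radical ideals, then $$\mathrm{Per}(\omega)_{\mathrm{red}}=\mathrm{Kup}(\omega)_{\mathrm{red}}$$ as closed subschemes of $X$; equivalently, $\sqrt{\mathcal{I}(\omega)}=\sqrt{\mathcal{K}(\omega)}$. -/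

import Mathlib

open CategoryTheory AlgebraicGeometry
universe u

noncomputable section

namespace Foliation

open KaehlerDifferential TopologicalSpace Opposite
open scoped TensorProduct

section Algebra
variable (k : Type*) (R : Type*) [CommRing k] [CommRing R] [Algebra k R]

/-- The wedge product `M × M → ⋀² M`, as a bilinear map. -/
def wedge {R : Type*} [CommRing R] {M : Type*} [AddCommGroup M] [Module R M] :
    M →ₗ[R] M →ₗ[R] ⋀[R]^2 M :=
  LinearMap.mk₂ R (fun a b => exteriorPower.ιMulti R 2 ![a, b])
    (fun a a' b => (exteriorPower.ιMulti R 2 (M := M)).map_vecCons_add ![b] a a')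
    (fun c a b => (exteriorPower.ιMulti R 2 (M := M)).map_vecCons_smul ![b] c a)
    (fun a b b' => by
      have e (z : M) : Function.update ![a, b] 1 z = ![a, z] := by
        ext i; fin_cases i <;> rfl
      simpa only [e] using (exteriorPower.ιMulti R 2 (M := M)).map_update_add ![a, b] 1 b b')
    (fun c a b => by
      have e (z : M) : Function.update ![a, b] 1 z = ![a, z] := by
        ext i; fin_cases i <;> rfl
      simpa only [e] using (exteriorPower.ιMulti R 2 (M := M)).map_update_smul ![a, b] 1 c b)

theorem wedge_apply {R : Type*} [CommRing R] {M : Type*} [AddCommGroup M] [Module R M]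
    (a b : M) : wedge (R := R) a b = exteriorPower.ιMulti R 2 ![a, b] := rfl

theorem wedge_self {R : Type*} [CommRing R] {M : Type*} [AddCommGroup M] [Module R M]
    (a : M) : wedge (R := R) a a = 0 :=
  (exteriorPower.ιMulti R 2 (M := M)).map_eq_zero_of_eq ![a, a] (i := 0) (j := 1) rfl (by decide)

theorem wedge_swap {R : Type*} [CommRing R] {M : Type*} [AddCommGroup M] [Module R M]
    (a b : M) : wedge (R := R) a b = - wedge (R := R) b a := by
  have h := wedge_self (R := R) (a + b)
  simp only [map_add, LinearMap.add_apply, wedge_self, zero_add, add_zero] at h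
  rw [eq_neg_iff_add_eq_zero, add_comm]; exact h

/-- The additive map on formal sums `∑ f dg` that induces the de Rham differential. -/
def extDerivAux : (R →₀ R) →+ ⋀[R]^2 Ω[R⁄k] :=
  Finsupp.liftAddHom fun g =>
    ((wedge (R := R)).flip (D k R g)).toAddMonoidHom.comp (D k R : R →ₗ[k] Ω[R⁄k]).toAddMonoidHom

theorem extDerivAux_single (f g : R) :
    extDerivAux k R (Finsupp.single g f) = wedge (D k R f) (D k R g) := by
  simp [extDerivAux]

theorem extDerivAux_ker :
    (Finsupp.linearCombination R (D k R)).toAddMonoidHom.ker ≤ (extDerivAux k R).ker := by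
  intro x hx
  have hx' : x ∈ KaehlerDifferential.kerTotal k R := by
    rw [← KaehlerDifferential.kerTotal_eq]; exact hx
  rw [AddMonoidHom.mem_ker]
  rw [KaehlerDifferential.kerTotal] at hx'
  refine Submodule.closure_induction (p := fun x _ => extDerivAux k R x = 0) ?_ ?_ ?_ hx'
  · exact map_zero _
  · intro a b _ _ ha hb; rw [map_add, ha, hb, add_zero]
  · rintro r _ ((⟨⟨x, y⟩, rfl⟩ | ⟨⟨x, y⟩, rfl⟩) | ⟨x, rfl⟩)
    · simp only [smul_sub, smul_add, Finsupp.smul_single, map_sub, map_add, extDerivAux_single]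
      abel
    · simp only [smul_sub, smul_add, Finsupp.smul_single, map_sub, map_add, extDerivAux_single,
        smul_eq_mul, mul_one, Derivation.leibniz, LinearMap.add_apply, map_smul, LinearMap.smul_apply]
      rw [wedge_swap (D k R y) (D k R x)]
      module
    · simp [Finsupp.smul_single, extDerivAux_single]

/-- The de Rham differential `Ω¹ → Ω²` of a `k`-algebra `R`, the additive map characterised by
`d (f dg) = df ∧ dg` (see `extDeriv_smul_D`). -/
def extDeriv : Ω[R⁄k] →+ ⋀[R]^2 Ω[R⁄k] :=
  AddMonoidHom.liftOfSurjective (Finsupp.linearCombination R (D k R)).toAddMonoidHom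
    (KaehlerDifferential.linearCombination_surjective k R)
    ⟨extDerivAux k R, extDerivAux_ker k R⟩

variable {R} in
theorem extDeriv_smul_D (f g : R) :
    extDeriv k R (f • D k R g) = wedge (D k R f) (D k R g) := by
  have h := AddMonoidHom.liftOfRightInverse_comp_apply
    (Finsupp.linearCombination R (D k R)).toAddMonoidHom _
    (Function.rightInverse_surjInv (KaehlerDifferential.linearCombination_surjective k R))
    ⟨extDerivAux k R, extDerivAux_ker k R⟩ (Finsupp.single g f)
  rw [extDerivAux_single] at h
  rw [← h]
  simp [extDeriv, AddMonoidHom.liftOfSurjective]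


variable {R}

theorem forms_induction {p : Ω[R⁄k] → Prop} (h0 : p 0) (hadd : ∀ x y, p x → p y → p (x + y))
    (hs : ∀ f g : R, p (f • D k R g)) (x : Ω[R⁄k]) : p x := by
  obtain ⟨y, rfl⟩ := KaehlerDifferential.linearCombination_surjective k R x
  induction y using Finsupp.induction_linear with
  | zero => simpa using h0
  | add a b ha hb => rw [map_add]; exact hadd _ _ ha hb
  | single g f => simpa using hs f g

theorem extDeriv_smul (r : R) (x : Ω[R⁄k]) :
    extDeriv k R (r • x) = wedge (D k R r) x + r • extDeriv k R x := by
  induction x using forms_induction with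
  | h0 => simp
  | hadd x y hx hy => simp only [smul_add, map_add, hx, hy]; abel
  | hs f g =>
    rw [smul_smul, extDeriv_smul_D, extDeriv_smul_D, Derivation.leibniz]
    simp only [map_add, map_smul, LinearMap.add_apply, LinearMap.smul_apply]
    abel

variable {k}

/-- The ideal of all contractions `i_v e`, for `v` a vector field and `e ∈ E`, i.e. the image of
`Der_k(R) ⊗ E → R`. -/
def singularIdeal (E : Submodule R Ω[R⁄k]) : Ideal R :=
  Ideal.span {h | ∃ v : Derivation k R R, ∃ e ∈ E, h = v.liftKaehlerDifferential e}

/-- The image `E ∧ Ω¹` of `E ⊗ Ω¹ → Ω²`. -/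
def wedgeForms (E : Submodule R Ω[R⁄k]) : Submodule R (⋀[R]^2 Ω[R⁄k]) :=
  Submodule.span R {x | ∃ e ∈ E, ∃ η : Ω[R⁄k], x = wedge e η}

/-- The annihilator of the classes of the `d e`, `e ∈ E`, in `Ω² / W`. -/
def annIdeal (E : Submodule R Ω[R⁄k]) (W : Submodule R (⋀[R]^2 Ω[R⁄k])) : Ideal R where
  carrier := {h | ∀ e ∈ E, h • extDeriv k R e ∈ W}
  zero_mem' := by intro e _; simp
  add_mem' := by intro a b ha hb e he; rw [add_smul]; exact W.add_mem (ha e he) (hb e he)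
  smul_mem' := by intro c a ha e he; rw [smul_assoc]; exact W.smul_mem _ (ha e he)

/-- The ideal of persistent singularities: all `h` such that `h · de ∈ E ∧ Ω¹` for all `e ∈ E`.
If `E` is the module of sections of `ω : L → Ω¹`, then `E ∧ Ω¹` is the module of coboundaries in
degree `2` of the Koszul complex of `ω` (twisted by `L²`), so this is the annihilator of the class
`[dω]` in the second Koszul cohomology. -/
def persistentIdeal (E : Submodule R Ω[R⁄k]) : Ideal R := annIdeal E (wedgeForms E)

/-- The Kupka ideal: all `h` such that `h · de ∈ J Ω²` for all `e ∈ E`, with `J = singularIdeal E`;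
equivalently the annihilator of the class `{dω}` in `Ω² ⊗ R/J`, twisted by `L⁻¹`. -/
def kupkaIdeal (E : Submodule R Ω[R⁄k]) : Ideal R :=
  annIdeal E (singularIdeal E • (⊤ : Submodule R (⋀[R]^2 Ω[R⁄k])))

theorem wedge_span_top (M : Type*) [AddCommGroup M] [Module R M] :
    Submodule.span R (Set.range fun x : M × M => wedge (R := R) x.1 x.2) = ⊤ := by
  rw [eq_top_iff, ← exteriorPower.ιMulti_span R 2 M, Submodule.span_le]
  rintro _ ⟨v, rfl⟩
  refine Submodule.subset_span ⟨(v 0, v 1), ?_⟩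
  change wedge (R := R) (v 0) (v 1) = _
  rw [wedge_apply]; congr 1; ext i; fin_cases i <;> rfl

section Localization

/-- A bilinear alternating map induces a linear map on the second exterior power. -/
def ofBilin {M N : Type*} [AddCommGroup M] [Module R M] [AddCommGroup N] [Module R N]
    (B : M →ₗ[R] M →ₗ[R] N) (hB : ∀ x, B x x = 0) : ⋀[R]^2 M →ₗ[R] N :=
  exteriorPower.alternatingMapLinearEquiv
    { toFun := fun v => B (v 0) (v 1)
      map_update_add' := by
        intro _ v i x y
        fin_cases i <;> simp [Function.update]
      map_update_smul' := by
        intro _ v i c x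
        fin_cases i <;> simp [Function.update]
      map_eq_zero_of_eq' := by
        intro v i j h hij
        fin_cases i <;> fin_cases j <;> simp_all }

theorem ofBilin_wedge {M N : Type*} [AddCommGroup M] [Module R M] [AddCommGroup N] [Module R N]
    (B : M →ₗ[R] M →ₗ[R] N) (hB : ∀ x, B x x = 0) (x y : M) :
    ofBilin B hB (wedge x y) = B x y := by
  rw [ofBilin, wedge_apply, exteriorPower.alternatingMapLinearEquiv_apply_ιMulti]
  rfl

variable {R' : Type*} [CommRing R'] [Algebra R R'] {M M' : Type*} [AddCommGroup M] [Module R M]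
  [AddCommGroup M'] [Module R M'] [Module R' M'] [IsScalarTower R R' M']

/-- The map on second exterior powers induced by a linear map over a ring homomorphism. -/
def wedgeMap (f : M →ₗ[R] M') : ⋀[R]^2 M →ₗ[R] ⋀[R']^2 M' :=
  ofBilin (N := ⋀[R']^2 M') (LinearMap.mk₂ R (fun a b => wedge (R := R') (f a) (f b))
    (by intros; simp)
    (by intro c a b
        rw [map_smul, ← algebraMap_smul R' c (f a), map_smul, LinearMap.smul_apply,
          algebraMap_smul])
    (by intros; simp)
    (by intro c a b
        rw [map_smul, ← algebraMap_smul R' c (f b), map_smul, algebraMap_smul]))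
    (by intro x; exact wedge_self _)

theorem wedgeMap_wedge (f : M →ₗ[R] M') (a b : M) :
    wedgeMap (R' := R') f (wedge a b) = wedge (f a) (f b) := ofBilin_wedge _ _ _ _

theorem exists_smul_eq_zero_of_wedgeMap (p : Submonoid R) [IsLocalization p R'] (f : M →ₗ[R] M')
    [IsLocalizedModule p f] (y : ⋀[R]^2 M) (hy : wedgeMap (R' := R') f y = 0) :
    ∃ s ∈ p, s • y = 0 := by
  let mk : ⋀[R]^2 M →ₗ[R] R' ⊗[R] (⋀[R]^2 M) := TensorProduct.mk R R' _ 1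
  have : IsLocalizedModule p mk :=
    (isLocalizedModule_iff_isBaseChange p R' mk).mpr (TensorProduct.isBaseChange R _ R')
  let C : M →ₗ[R] (M' →ₗ[R] R' ⊗[R] (⋀[R]^2 M)) :=
    (IsLocalizedModule.map p f mk) ∘ₗ (wedge (R := R) (M := M))
  have hu : ∀ s : p, IsUnit ((algebraMap R (Module.End R
      (M' →ₗ[R] R' ⊗[R] (⋀[R]^2 M)))) s) := by
    intro s
    obtain ⟨u, hu⟩ := IsLocalizedModule.map_units mk s
    refine ⟨⟨LinearMap.llcomp R M' _ _ u.1, LinearMap.llcomp R M' _ _ u.2, ?_, ?_⟩, ?_⟩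
    · ext g x; exact LinearMap.congr_fun u.3 (g x)
    · ext g x; exact LinearMap.congr_fun u.4 (g x)
    · ext g x; exact LinearMap.congr_fun hu (g x)
  let C' : M' →ₗ[R] (M' →ₗ[R] R' ⊗[R] (⋀[R]^2 M)) := IsLocalizedModule.lift p f C hu
  have hC (a b : M) : C' (f a) (f b) = mk (wedge a b) := by
    simp only [C', IsLocalizedModule.lift_apply, C, LinearMap.comp_apply,
      IsLocalizedModule.map_apply]
  have hinj (s : p) (z : R' ⊗[R] (⋀[R]^2 M)) (h : (s : R) • z = 0) : z = 0 :=
    IsLocalizedModule.smul_injective mk s (by simpa [Submonoid.smul_def] using h)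
  have hCC (x : M') : C' x x = 0 := by
    obtain ⟨⟨m, s⟩, hm⟩ := IsLocalizedModule.surj p f x
    have hm' : (s : R) • x = f m := hm
    refine hinj s _ (hinj s _ ?_)
    rw [← LinearMap.map_smul, ← LinearMap.smul_apply, ← LinearMap.map_smul, hm', hC, wedge_self,
      map_zero]
  let T : M' →ₗ[R'] (M' →ₗ[R'] R' ⊗[R] (⋀[R]^2 M)) :=
    LinearMap.extendScalarsOfIsLocalization p R'
      { toFun := fun x => LinearMap.extendScalarsOfIsLocalization p R' (C' x)
        map_add' := by intro x y; ext z; simp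
        map_smul' := by intro c x; ext z; simp }
  let G := ofBilin T hCC
  have hG : ∀ z : ⋀[R]^2 M, G (wedgeMap (R' := R') f z) = mk z := by
    intro z
    have hz : z ∈ Submodule.span R (Set.range fun x : M × M => wedge (R := R) x.1 x.2) := by
      rw [wedge_span_top]; trivial
    induction hz using Submodule.span_induction with
    | zero => simp
    | add x y _ _ hx hy => simp only [map_add, hx, hy]
    | smul c x _ hx =>
      rw [LinearMap.map_smul, LinearMap.map_smul, ← hx,
        ← algebraMap_smul R' c (wedgeMap (R' := R') f x), LinearMap.map_smul, algebraMap_smul]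
    | mem x h =>
      obtain ⟨⟨a, b⟩, rfl⟩ := h
      change G (wedgeMap (R' := R') f (wedge a b)) = mk (wedge a b)
      rw [wedgeMap_wedge]
      exact (ofBilin_wedge T hCC (f a) (f b)).trans (hC a b)
  have h0 : mk y = 0 := by rw [← hG, hy, map_zero]
  obtain ⟨s, hs⟩ := (IsLocalizedModule.eq_zero_iff p mk).mp h0
  exact ⟨s, s.2, hs⟩


theorem exists_smul_eq_wedgeMap (p : Submonoid R) [IsLocalization p R'] (f : M →ₗ[R] M')
    (W : Submodule R (⋀[R]^2 M)) (S : Set (⋀[R']^2 M'))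
    (hS : ∀ x ∈ S, ∃ s ∈ p, ∃ w ∈ W, s • x = wedgeMap (R' := R') f w) (x : ⋀[R']^2 M')
    (hx : x ∈ Submodule.span R' S) : ∃ s ∈ p, ∃ w ∈ W, s • x = wedgeMap (R' := R') f w := by
  induction hx using Submodule.span_induction with
  | mem x h => exact hS x h
  | zero => exact ⟨1, p.one_mem, 0, W.zero_mem, by simp⟩
  | add x y _ _ hx hy =>
    obtain ⟨s, hs, w, hw, h⟩ := hx
    obtain ⟨t, ht, v, hv, h'⟩ := hy
    refine ⟨s * t, p.mul_mem hs ht, t • w + s • v, W.add_mem (W.smul_mem _ hw) (W.smul_mem _ hv), ?_⟩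
    rw [map_add, LinearMap.map_smul, LinearMap.map_smul, ← h, ← h', smul_add, smul_smul, smul_smul,
      mul_comm t s]
  | smul c x _ hx =>
    obtain ⟨s, hs, w, hw, h⟩ := hx
    obtain ⟨⟨a, t⟩, hat⟩ := IsLocalization.surj p c
    refine ⟨t * s, p.mul_mem t.2 hs, a • w, W.smul_mem _ hw, ?_⟩
    rw [LinearMap.map_smul, ← h, ← algebraMap_smul R' ((t : R) * s), ← algebraMap_smul R' a,
      ← algebraMap_smul R' s, smul_smul, smul_smul, ← hat, map_mul]
    congr 1; ring

theorem exists_smul_mem_of_wedgeMap_mem (p : Submonoid R) [IsLocalization p R'] (f : M →ₗ[R] M')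
    [IsLocalizedModule p f]
    (W : Submodule R (⋀[R]^2 M)) (S : Set (⋀[R']^2 M'))
    (hS : ∀ x ∈ S, ∃ s ∈ p, ∃ w ∈ W, s • x = wedgeMap (R' := R') f w) (y : ⋀[R]^2 M)
    (hy : wedgeMap (R' := R') f y ∈ Submodule.span R' S) : ∃ s ∈ p, s • y ∈ W := by
  obtain ⟨s, hs, w, hw, h⟩ := exists_smul_eq_wedgeMap p f W S hS _ hy
  obtain ⟨t, ht, h0⟩ := exists_smul_eq_zero_of_wedgeMap (R' := R') p f (s • y - w)
    (by rw [map_sub, LinearMap.map_smul, h, sub_self])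
  refine ⟨t * s, p.mul_mem ht hs, ?_⟩
  rw [smul_sub, sub_eq_zero, smul_smul] at h0
  rw [h0]
  exact W.smul_mem _ hw

end Localization

section LocalizationForms

variable {R' : Type*} [CommRing R'] [Algebra k R'] [Algebra R R'] [IsScalarTower k R R']

variable (k R R') in
/-- Pull-back of `1`-forms along `R → R'`. -/
abbrev formMap : Ω[R⁄k] →ₗ[R] Ω[R'⁄k] := KaehlerDifferential.map k k R R'

theorem extDeriv_map (x : Ω[R⁄k]) :
    extDeriv k R' (formMap k R R' x) = wedgeMap (R' := R') (formMap k R R') (extDeriv k R x) := by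
  induction x using forms_induction with
  | h0 => simp
  | hadd x y hx hy => simp only [map_add, hx, hy]
  | hs f g =>
    rw [extDeriv_smul_D, wedgeMap_wedge, LinearMap.map_smul, KaehlerDifferential.map_D,
      KaehlerDifferential.map_D, ← algebraMap_smul R' f, extDeriv_smul_D]

variable (p : Submonoid R) [IsLocalization p R'] {E : Submodule R Ω[R⁄k]}
  {E' : Submodule R' Ω[R'⁄k]}

theorem map_annIdeal (hE : ∀ e ∈ E, formMap k R R' e ∈ E')
    (hE' : ∀ e' ∈ E', ∃ s ∈ p, ∃ e ∈ E, s • e' = formMap k R R' e) (hfg : E.FG)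
    {W : Submodule R (⋀[R]^2 Ω[R⁄k])} {W' : Submodule R' (⋀[R']^2 Ω[R'⁄k])}
    (hW : ∀ e ∈ E, ∀ η, wedge e η ∈ W) (hW' : ∀ e ∈ E', ∀ η, wedge e η ∈ W')
    (h1 : ∀ w ∈ W, wedgeMap (R' := R') (formMap k R R') w ∈ W')
    (h2 : ∀ y, wedgeMap (R' := R') (formMap k R R') y ∈ W' → ∃ s ∈ p, s • y ∈ W) :
    (annIdeal E W).map (algebraMap R R') = annIdeal E' W' := by
  apply le_antisymm
  · rw [Ideal.map_le_iff_le_comap]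
    intro h hh e' he'
    obtain ⟨s, hs, e, he, hse⟩ := hE' e' he'
    have hu : IsUnit (algebraMap R R' s) := IsLocalization.map_units R' ⟨s, hs⟩
    have key : algebraMap R R' s • (algebraMap R R' h • extDeriv k R' e') ∈ W' := by
      have h4 := extDeriv_smul k (algebraMap R R' s) e'
      rw [algebraMap_smul R' s e', hse, extDeriv_map, wedge_swap] at h4
      have h5 : algebraMap R R' s • extDeriv k R' e' =
          wedgeMap (R' := R') (formMap k R R') (extDeriv k R e)
            + wedge e' (D k R' (algebraMap R R' s)) := by
        rw [h4]; abel
      rw [smul_comm, h5, smul_add]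
      refine W'.add_mem ?_ (W'.smul_mem _ (hW' e' he' _))
      rw [algebraMap_smul, ← LinearMap.map_smul]
      exact h1 _ (hh e he)
    exact (Submodule.smul_mem_iff_of_isUnit W' hu).mp key
  · intro h' hh'
    obtain ⟨⟨h0, s0⟩, hs0⟩ := IsLocalization.surj p h'
    obtain ⟨S, rfl⟩ := hfg
    have hex : ∀ e ∈ S, ∃ s ∈ p, s • h0 • extDeriv k R e ∈ W := by
      intro e he
      refine h2 _ ?_
      rw [LinearMap.map_smul, ← extDeriv_map, ← algebraMap_smul R' h0, ← hs0, mul_comm, mul_smul]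
      exact W'.smul_mem _ (hh' _ (hE e (Submodule.subset_span he)))
    choose! s hs hsW using hex
    classical
    let t := ∏ e ∈ S, s e
    have ht : t ∈ p := p.prod_mem hs
    have hth : t * h0 ∈ annIdeal (Submodule.span R (S : Set Ω[R⁄k])) W := by
      intro e he
      induction he using Submodule.span_induction with
      | mem e he =>
        obtain ⟨c, hc⟩ := Finset.dvd_prod_of_mem s he
        have : t = c * s e := by rw [mul_comm]; exact hc
        rw [this, mul_assoc, mul_smul, mul_smul]
        exact W.smul_mem _ (hsW e he)
      | zero => simp
      | add x y _ _ hx hy => rw [map_add, smul_add]; exact W.add_mem hx hy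
      | smul r x hx' hx =>
        rw [extDeriv_smul, wedge_swap, smul_add, smul_comm _ r]
        exact W.add_mem (W.smul_mem _ (W.neg_mem (hW x hx' _))) (W.smul_mem _ hx)
    rw [IsLocalization.mem_map_algebraMap_iff p]
    refine ⟨⟨⟨_, hth⟩, ⟨t, ht⟩ * s0⟩, ?_⟩
    change h' * algebraMap R R' (t * s0) = algebraMap R R' (t * h0)
    rw [map_mul, map_mul, ← hs0]; ring

theorem wedge_mem_wedgeForms {e : Ω[R⁄k]} (he : e ∈ E) (η : Ω[R⁄k]) : wedge e η ∈ wedgeForms E :=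
  Submodule.subset_span ⟨e, he, η, rfl⟩

theorem dual_apply_mem_singularIdeal (φ : Ω[R⁄k] →ₗ[R] R) {e : Ω[R⁄k]} (he : e ∈ E) :
    φ e ∈ singularIdeal E := by
  refine Ideal.subset_span ⟨φ.compDer (D k R), e, he, ?_⟩
  rw [Derivation.liftKaehlerDifferential_unique (φ.compDer (D k R)).liftKaehlerDifferential φ
    (Derivation.liftKaehlerDifferential_comp _)]

theorem wedge_mem_singularIdeal_smul_top [Module.Finite R Ω[R⁄k]] [Module.Projective R Ω[R⁄k]]
    {e : Ω[R⁄k]} (he : e ∈ E) (η : Ω[R⁄k]) :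
    wedge e η ∈ singularIdeal E • (⊤ : Submodule R (⋀[R]^2 Ω[R⁄k])) := by
  obtain ⟨n, f, g, -, -, hfg⟩ := Module.Finite.exists_comp_eq_id_of_projective R Ω[R⁄k]
  have he' : e = f (g e) := (LinearMap.congr_fun hfg e).symm
  have h2 : f (g e) = ∑ i, (g e i) • f (Pi.single i 1) := by
    conv_lhs => rw [pi_eq_sum_univ' (g e)]
    rw [map_sum]
    refine Finset.sum_congr rfl fun i _ => ?_
    rw [map_smul]
  rw [he', h2, map_sum, LinearMap.sum_apply]
  refine Submodule.sum_mem _ fun i _ => ?_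
  rw [map_smul, LinearMap.smul_apply]
  exact Submodule.smul_mem_smul
    (dual_apply_mem_singularIdeal (LinearMap.proj i ∘ₗ g) he) trivial

theorem map_singularIdeal [Module.FinitePresentation R Ω[R⁄k]]
    (hE : ∀ e ∈ E, formMap k R R' e ∈ E')
    (hE' : ∀ e' ∈ E', ∃ s ∈ p, ∃ e ∈ E, s • e' = formMap k R R' e) :
    (singularIdeal E).map (algebraMap R R') = singularIdeal E' := by
  have : IsLocalizedModule p (formMap k R R') := KaehlerDifferential.isLocalizedModule_map ..
  apply le_antisymm
  · rw [singularIdeal, Ideal.map_span, Ideal.span_le]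
    rintro _ ⟨_, ⟨v, e, he, rfl⟩, rfl⟩
    let φ : Ω[R'⁄k] →ₗ[R'] R' := LinearMap.extendScalarsOfIsLocalization p R'
      (IsLocalizedModule.map p (formMap k R R') (Algebra.linearMap R R')
        v.liftKaehlerDifferential)
    have hφ : algebraMap R R' (v.liftKaehlerDifferential e) = φ (formMap k R R' e) := by
      simp only [φ, LinearMap.extendScalarsOfIsLocalization_apply']
      rw [IsLocalizedModule.map_apply]; rfl
    rw [hφ]
    exact dual_apply_mem_singularIdeal φ (hE e he)
  · rw [singularIdeal, Ideal.span_le]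
    rintro _ ⟨v, e', he', rfl⟩
    obtain ⟨s, hs, e, he, hse⟩ := hE' e' he'
    obtain ⟨ψ, t, hψ⟩ := Module.FinitePresentation.exists_lift_of_isLocalizedModule p
      (Algebra.linearMap R R')
      ((v.liftKaehlerDifferential.restrictScalars R) ∘ₗ (formMap k R R'))
    have h := LinearMap.congr_fun hψ e
    rw [SetLike.mem_coe, IsLocalization.mem_map_algebraMap_iff p]
    refine ⟨⟨⟨ψ e, dual_apply_mem_singularIdeal ψ he⟩, t * ⟨s, hs⟩⟩, ?_⟩
    change _ * algebraMap R R' (t * s) = algebraMap R R' (ψ e)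
    have h' : algebraMap R R' (ψ e) = (t : R) • v.liftKaehlerDifferential (formMap k R R' e) := h
    rw [h', ← hse, ← algebraMap_smul R' s, LinearMap.map_smul, Algebra.smul_def, map_mul,
      smul_eq_mul]
    ring

theorem map_persistentIdeal [Module.Finite R Ω[R⁄k]] [IsNoetherianRing R]
    (hE : ∀ e ∈ E, formMap k R R' e ∈ E')
    (hE' : ∀ e' ∈ E', ∃ s ∈ p, ∃ e ∈ E, s • e' = formMap k R R' e) :
    (persistentIdeal E).map (algebraMap R R') = persistentIdeal E' := by
  have hl : IsLocalizedModule p (formMap k R R') := KaehlerDifferential.isLocalizedModule_map ..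
  refine map_annIdeal p hE hE' (IsNoetherian.noetherian E) (fun e he η => wedge_mem_wedgeForms he η)
    (fun e he η => wedge_mem_wedgeForms he η) ?_ ?_
  · intro w hw
    induction hw using Submodule.span_induction with
    | mem x h =>
      obtain ⟨e, he, η, rfl⟩ := h
      rw [wedgeMap_wedge]
      exact wedge_mem_wedgeForms (hE e he) _
    | zero => simp
    | add x y _ _ hx hy => rw [map_add]; exact Submodule.add_mem _ hx hy
    | smul r x _ hx =>
      rw [LinearMap.map_smul, ← algebraMap_smul R' r]
      exact Submodule.smul_mem _ _ hx
  · intro y hy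
    refine exists_smul_mem_of_wedgeMap_mem (R' := R') p (formMap k R R') _ _ ?_ y hy
    rintro _ ⟨e', he', η', rfl⟩
    obtain ⟨s, hs, e, he, hse⟩ := hE' e' he'
    obtain ⟨⟨η, t⟩, ht⟩ := IsLocalizedModule.surj p (formMap k R R') η'
    have ht' : (t : R) • η' = formMap k R R' η := ht
    refine ⟨s * t, p.mul_mem hs t.2, wedge e η, wedge_mem_wedgeForms he η, ?_⟩
    rw [wedgeMap_wedge, ← hse, ← ht', ← algebraMap_smul R' s e', ← algebraMap_smul R' (t : R) η',
      LinearMap.map_smul, LinearMap.map_smul, LinearMap.smul_apply, ← algebraMap_smul R' (s * t),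
      map_mul, mul_smul, smul_comm]

theorem map_kupkaIdeal [Module.Finite R Ω[R⁄k]] [IsNoetherianRing R] [Module.Projective R Ω[R⁄k]]
    (hE : ∀ e ∈ E, formMap k R R' e ∈ E')
    (hE' : ∀ e' ∈ E', ∃ s ∈ p, ∃ e ∈ E, s • e' = formMap k R R' e) :
    (kupkaIdeal E).map (algebraMap R R') = kupkaIdeal E' := by
  have hl : IsLocalizedModule p (formMap k R R') := KaehlerDifferential.isLocalizedModule_map ..
  have hfp : Module.FinitePresentation R Ω[R⁄k] := Module.finitePresentation_of_finite R _
  have hb : IsBaseChange R' (formMap k R R') :=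
    (isLocalizedModule_iff_isBaseChange p R' _).mp hl
  have : Module.Finite R' Ω[R'⁄k] := Module.Finite.of_isLocalizedModule p (formMap k R R')
  have : Module.Projective R' Ω[R'⁄k] := Module.Projective.of_equiv hb.equiv
  have hJ := map_singularIdeal p hE hE'
  refine map_annIdeal p hE hE' (IsNoetherian.noetherian E)
    (fun e he η => wedge_mem_singularIdeal_smul_top he η)
    (fun e he η => wedge_mem_singularIdeal_smul_top he η) ?_ ?_
  · intro w hw
    refine Submodule.smul_induction_on hw ?_ ?_
    · intro r hr x _
      rw [LinearMap.map_smul, ← algebraMap_smul R' r]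
      refine Submodule.smul_mem_smul ?_ trivial
      rw [← hJ]
      exact Ideal.mem_map_of_mem _ hr
    · intro x y hx hy; rw [map_add]; exact Submodule.add_mem _ hx hy
  · intro y hy
    refine exists_smul_mem_of_wedgeMap_mem (R' := R') p (formMap k R R') _
      {x | ∃ r ∈ singularIdeal E', ∃ z, x = r • z} ?_ y ?_
    · rintro _ ⟨r', hr', z', rfl⟩
      rw [← hJ, IsLocalization.mem_map_algebraMap_iff p] at hr'
      obtain ⟨⟨⟨r, hr⟩, s⟩, hrs⟩ := hr'
      have hz' : z' ∈ Submodule.span R'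
          (Set.range fun x : Ω[R'⁄k] × Ω[R'⁄k] => wedge (R := R') x.1 x.2) := by
        rw [wedge_span_top]; trivial
      obtain ⟨t, ht, z, -, hz⟩ := exists_smul_eq_wedgeMap p (formMap k R R') ⊤ _ (by
        rintro _ ⟨⟨a', b'⟩, rfl⟩
        obtain ⟨⟨a, u⟩, hu⟩ := IsLocalizedModule.surj p (formMap k R R') a'
        obtain ⟨⟨b, v⟩, hv⟩ := IsLocalizedModule.surj p (formMap k R R') b'
        have hu' : (u : R) • a' = formMap k R R' a := hu
        have hv' : (v : R) • b' = formMap k R R' b := hv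
        refine ⟨u * v, p.mul_mem u.2 v.2, wedge a b, trivial, ?_⟩
        rw [wedgeMap_wedge, ← hu', ← hv', ← algebraMap_smul R' (u : R) a',
          ← algebraMap_smul R' (v : R) b', LinearMap.map_smul, LinearMap.map_smul,
          LinearMap.smul_apply, ← algebraMap_smul R' ((u : R) * v), map_mul, mul_smul, smul_comm])
          z' hz'
      refine ⟨s * t, p.mul_mem s.2 ht, r • z, Submodule.smul_mem_smul hr trivial, ?_⟩
      have hrs' : r' * algebraMap R R' s = algebraMap R R' r := hrs
      rw [LinearMap.map_smul, ← hz, ← algebraMap_smul R' r, ← hrs', ← algebraMap_smul R' t,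
        ← algebraMap_smul R' ((s : R) * t), smul_smul, smul_smul, map_mul]
      congr 1; ring
    · refine Submodule.smul_induction_on hy ?_ ?_
      · intro r hr z _; exact Submodule.subset_span ⟨r, hr, z, rfl⟩
      · intro _ _ hx hy; exact Submodule.add_mem _ hx hy

end LocalizationForms



end Algebra
section Sheaf
variable {X : Scheme.{u}}

/-- Restriction of functions. -/
abbrev resO {U V : X.Opens} (h : V ≤ U) : Γ(X, U) →+* Γ(X, V) :=
  (X.presheaf.map (homOfLE h).op).hom

/-- Restriction of sections of a sheaf of modules. -/
abbrev resL (L : X.Modules) {U V : X.Opens} (h : V ≤ U) : Γ(L, U) →+ Γ(L, V) :=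
  (L.presheaf.map (homOfLE h).op).hom

theorem resO_resO {U V W : X.Opens} (h : V ≤ U) (h' : W ≤ V) (r : Γ(X, U)) :
    resO h' (resO h r) = resO (h'.trans h) r := by
  rw [resO, resO, resO, ← RingHom.comp_apply, ← CommRingCat.hom_comp, ← Functor.map_comp]; rfl

theorem resL_resL (L : X.Modules) {U V W : X.Opens} (h : V ≤ U) (h' : W ≤ V) (r : Γ(L, U)) :
    resL L h' (resL L h r) = resL L (h'.trans h) r := by
  rw [resL, resL, resL, ← AddMonoidHom.comp_apply, ← AddCommGrpCat.hom_comp, ← Functor.map_comp]; rfl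

theorem resL_smul (L : X.Modules) {U V : X.Opens} (h : V ≤ U) (r : Γ(X, U)) (s : Γ(L, U)) :
    resL L h (r • s) = resO h r • resL L h s := L.map_smul _ _ _

/-- `L` is a line bundle: every point has an open neighbourhood `U` with a section `s ∈ L(U)` such
that `𝒪_U → L|_U`, `r ↦ r s`, is an isomorphism, i.e. bijective on sections over every `V ≤ U`. -/
def IsLineBundle (L : X.Modules) : Prop :=
  ∀ x : X, ∃ (U : X.Opens) (_ : x ∈ U) (s : Γ(L, U)), ∀ (V : X.Opens) (h : V ≤ U),
    Function.Bijective fun r : Γ(X, V) => r • resL L h s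

theorem exists_extend {U V : X.Opens} (hV : IsAffineOpen V) (h : V ≤ U) (f : Γ(X, U))
    (r : Γ(X, V ⊓ X.basicOpen f)) :
    ∃ (n : ℕ) (a : Γ(X, V)), resO inf_le_left a = resO (inf_le_left.trans h) f ^ n * r := by
  let := (resO (X := X) (inf_le_left : V ⊓ X.basicOpen f ≤ V)).toAlgebra
  have : IsLocalization.Away (resO h f) Γ(X, V ⊓ X.basicOpen f) :=
    hV.isLocalization_of_eq_basicOpen (resO h f) (homOfLE inf_le_left)
      (X.basicOpen_res _ _).symm
  obtain ⟨⟨a, ⟨_, n, rfl⟩⟩, ha⟩ := IsLocalization.surj (Submonoid.powers (resO h f)) r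
  refine ⟨n, a, ?_⟩
  have ha' : r * resO inf_le_left (resO h f ^ n) = resO inf_le_left a := ha
  rw [← ha', map_pow, resO_resO, mul_comm]

theorem exists_kill {U V : X.Opens} (hV : IsAffineOpen V) (h : V ≤ U) (f : Γ(X, U))
    (c : Γ(X, V)) (hc : resO (inf_le_left : V ⊓ X.basicOpen f ≤ V) c = 0) :
    ∃ n : ℕ, resO h f ^ n * c = 0 := by
  let := (resO (X := X) (inf_le_left : V ⊓ X.basicOpen f ≤ V)).toAlgebra
  have : IsLocalization.Away (resO h f) Γ(X, V ⊓ X.basicOpen f) :=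
    hV.isLocalization_of_eq_basicOpen (resO h f) (homOfLE inf_le_left)
      (X.basicOpen_res _ _).symm
  have h0 : algebraMap Γ(X, V) Γ(X, V ⊓ X.basicOpen f) c = 0 := hc
  rw [IsLocalization.map_eq_zero_iff (Submonoid.powers (resO h f))] at h0
  obtain ⟨⟨_, n, rfl⟩, hn⟩ := h0
  exact ⟨n, hn⟩

theorem IsLineBundle.exists_extend {L : X.Modules} (hL : IsLineBundle L) {U : X.Opens}
    (hU : IsAffineOpen U) (f : Γ(X, U)) (t : Γ(L, X.basicOpen f)) :
    ∃ (n : ℕ) (s : Γ(L, U)), resL L (X.basicOpen_le f) s = resO (X.basicOpen_le f) f ^ n • t := by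
  -- a finite cover of `U` by basic opens on which `L` is trivial
  have hloc (x : U) : ∃ g : Γ(X, U), x.1 ∈ X.basicOpen g ∧ ∃ s : Γ(L, X.basicOpen g),
      ∀ (V : X.Opens) (h : V ≤ X.basicOpen g),
        Function.Bijective fun r : Γ(X, V) => r • resL L h s := by
    obtain ⟨W, hxW, s, hs⟩ := hL x.1
    obtain ⟨g, hgW, hxg⟩ := hU.exists_basicOpen_le ⟨x.1, hxW⟩ x.2
    refine ⟨g, hxg, resL L hgW s, fun V h => ?_⟩
    simp only [resL_resL]
    exact hs V _
  choose g hg s hs using hloc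
  obtain ⟨T, hT⟩ := hU.isCompact.elim_finite_subcover (fun x : U => (X.basicOpen (g x) : Set X))
    (fun x => (X.basicOpen (g x)).isOpen) (fun x hx => Set.mem_iUnion.mpr ⟨⟨x, hx⟩, hg _⟩)
  have hcov : U ≤ ⨆ i : T, X.basicOpen (g i) := by
    intro x hx
    obtain ⟨i, hi, hxi⟩ := Set.mem_iUnion₂.mp (hT hx)
    exact Opens.mem_iSup.mpr ⟨⟨i, hi⟩, hxi⟩
  have hle (i : T) : X.basicOpen (g i) ≤ U := X.basicOpen_le _
  have hD : X.basicOpen f ≤ U := X.basicOpen_le f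
  have wl (i : T) : X.basicOpen (g i) ⊓ X.basicOpen f ≤ U := inf_le_left.trans (hle i)
  have wr (i : T) : X.basicOpen (g i) ⊓ X.basicOpen f ≤ X.basicOpen f := inf_le_right
  have pl (i j : T) : X.basicOpen (g i) ⊓ X.basicOpen (g j) ≤ X.basicOpen (g i) := inf_le_left
  have pr (i j : T) : X.basicOpen (g i) ⊓ X.basicOpen (g j) ≤ X.basicOpen (g j) := inf_le_right
  -- extend locally
  have h1 (i : T) : ∃ (n : ℕ) (u : Γ(L, X.basicOpen (g i))),
      resL L (inf_le_left : X.basicOpen (g i) ⊓ X.basicOpen f ≤ _) u =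
        resO (wl i) f ^ n • resL L (wr i) t := by
    obtain ⟨r, hr⟩ := (hs i (X.basicOpen (g i) ⊓ X.basicOpen f) inf_le_left).2
      (resL L (wr i) t)
    obtain ⟨n, a, ha⟩ := Foliation.exists_extend (hU.basicOpen (g i)) (hle i) f r
    refine ⟨n, a • s i, ?_⟩
    rw [resL_smul, ha, mul_smul]
    congr 1
  choose n u hu using h1
  let N := Finset.univ.sup n
  let u' (i : T) : Γ(L, X.basicOpen (g i)) := resO (hle i) f ^ (N - n i) • u i
  have hu' (i : T) : resL L (inf_le_left : X.basicOpen (g i) ⊓ X.basicOpen f ≤ _) (u' i) =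
        resO (wl i) f ^ N • resL L (wr i) t := by
    have hn : N = (N - n i) + n i := by
      have : n i ≤ N := Finset.le_sup (f := n) (Finset.mem_univ i)
      omega
    rw [resL_smul, hu, map_pow, resO_resO, smul_smul, ← pow_add, ← hn]
  clear_value u'
  -- correct on overlaps
  have h2 (i j : T) : ∃ m : ℕ, resO ((pl i j).trans (hle i)) f ^ m •
      (resL L (pl i j) (u' i) -
        resL L (pr i j) (u' j)) = 0 := by
    have haff : IsAffineOpen (X.basicOpen (g i) ⊓ X.basicOpen (g j)) := by
      rw [← X.basicOpen_mul]; exact hU.basicOpen _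
    obtain ⟨c, hc⟩ := (hs i (X.basicOpen (g i) ⊓ X.basicOpen (g j)) inf_le_left).2
      (resL L (pl i j) (u' i) -
        resL L (pr i j) (u' j))
    have hc0 : resO (inf_le_left : X.basicOpen (g i) ⊓ X.basicOpen (g j) ⊓ X.basicOpen f ≤ _) c
        = 0 := by
      apply (hs i (X.basicOpen (g i) ⊓ X.basicOpen (g j) ⊓ X.basicOpen f)
        (inf_le_left.trans inf_le_left)).1
      simp only [zero_smul]
      rw [← resL_resL L inf_le_left inf_le_left, ← resL_smul]
      have hc' : c • resL L (inf_le_left : X.basicOpen (g i) ⊓ X.basicOpen (g j) ≤ _) (s i) = _ :=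
        hc
      rw [hc', map_sub, resL_resL, resL_resL, sub_eq_zero]
      have e1 := congrArg (resL L (show X.basicOpen (g i) ⊓ X.basicOpen (g j) ⊓ X.basicOpen f ≤
        X.basicOpen (g i) ⊓ X.basicOpen f from inf_le_inf_right _ inf_le_left)) (hu' i)
      have e2 := congrArg (resL L (show X.basicOpen (g i) ⊓ X.basicOpen (g j) ⊓ X.basicOpen f ≤
        X.basicOpen (g j) ⊓ X.basicOpen f from inf_le_inf_right _ inf_le_right)) (hu' j)
      rw [resL_resL, resL_smul, map_pow, resO_resO, resL_resL] at e1 e2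
      rw [e1, e2]
    obtain ⟨m, hm⟩ := exists_kill haff (inf_le_left.trans (hle i)) f c hc0
    refine ⟨m, ?_⟩
    rw [← hc]
    simp only
    rw [smul_smul, hm, zero_smul]
  choose m hm using h2
  let M := Finset.univ.sup fun ij : T × T => m ij.1 ij.2
  obtain ⟨S, hS, -⟩ := TopCat.Sheaf.existsUnique_gluing' ⟨L.presheaf, L.isSheaf⟩
    (fun i : T => X.basicOpen (g i)) U (fun i => homOfLE (hle i)) hcov
    (fun i => resO (hle i) f ^ M • u' i) (by
      intro i j
      change resL L (pl i j) (resO (hle i) f ^ M • u' i) =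
        resL L (pr i j) (resO (hle j) f ^ M • u' j)
      have hM : M = (M - m i j) + m i j := by
        have : m i j ≤ M := Finset.le_sup (f := fun ij : T × T => m ij.1 ij.2)
          (Finset.mem_univ (i, j))
        omega
      rw [resL_smul, resL_smul, map_pow, map_pow, resO_resO, resO_resO, ← sub_eq_zero, ← smul_sub,
        hM, pow_add, mul_smul, hm, smul_zero])
  have hS' (i : T) : resL L (hle i) S = resO (hle i) f ^ M • u' i := hS i
  refine ⟨M + N, S, ?_⟩
  refine TopCat.Sheaf.eq_of_locally_eq' ⟨L.presheaf, L.isSheaf⟩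
    (fun i : T => X.basicOpen (g i) ⊓ X.basicOpen f) (X.basicOpen f)
    (fun i => homOfLE inf_le_right) ?_ _ _ ?_
  · rw [← iSup_inf_eq]
    exact le_inf (hD.trans hcov) le_rfl
  · intro i
    change resL L (inf_le_right : X.basicOpen (g i) ⊓ X.basicOpen f ≤ _) _ = resL L inf_le_right _
    rw [resL_resL, ← resL_resL L (hle i) inf_le_left, hS', resL_smul, hu', resL_smul, map_pow,
      map_pow, resO_resO, resO_resO, smul_smul, ← pow_add]

end Sheaf
section Foliations

variable (k : Type u) [Field k] {X : Scheme.{u}} [X.Over (Spec (.of k))]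

theorem le_preimage_top {X Y : Scheme.{u}} (f : X ⟶ Y) (U : X.Opens) : U ≤ f ⁻¹ᵁ ⊤ := le_top

/-- Sections of the structure sheaf of a `k`-scheme form a `k`-algebra. -/
instance sectionsAlgebra (U : X.Opens) : Algebra k Γ(X, U) :=
  (((X ↘ Spec (.of k)).appLE ⊤ U (le_preimage_top _ U)).hom.comp
    (Scheme.ΓSpecIso (CommRingCat.of k)).inv.hom).toAlgebra

theorem resO_algebraMap {U V : X.Opens} (h : V ≤ U) (c : k) :
    resO h (algebraMap k Γ(X, U) c) = algebraMap k Γ(X, V) c := by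
  change (X.presheaf.map (homOfLE h).op).hom (((X ↘ Spec (.of k)).appLE ⊤ U (le_preimage_top _ U)).hom _) =
    ((X ↘ Spec (.of k)).appLE ⊤ V (le_preimage_top _ V)).hom _
  rw [← RingHom.comp_apply, ← CommRingCat.hom_comp, Scheme.Hom.appLE_map]

/-- Restriction of `1`-forms between affine open subsets (`Ω¹_X(U) = Ω[Γ(X, U)⁄k]` for `U` affine):
the additive map with `a · dg ↦ a|_V · d(g|_V)`. -/
def formRes {U V : X.Opens} (h : V ≤ U) : Ω[Γ(X, U)⁄k] →+ Ω[Γ(X, V)⁄k] :=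
  letI : Algebra Γ(X, U) Γ(X, V) := (resO h).toAlgebra
  haveI : IsScalarTower k Γ(X, U) Γ(X, V) :=
    IsScalarTower.of_algebraMap_eq fun c => (resO_algebraMap k h c).symm
  (KaehlerDifferential.map k k Γ(X, U) Γ(X, V)).toAddMonoidHom

theorem formRes_smul_D {U V : X.Opens} (h : V ≤ U) (a g : Γ(X, U)) :
    formRes k h (a • D k Γ(X, U) g) = resO h a • D k Γ(X, V) (resO h g) := by
  let : Algebra Γ(X, U) Γ(X, V) := (resO h).toAlgebra
  have : IsScalarTower k Γ(X, U) Γ(X, V) :=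
    IsScalarTower.of_algebraMap_eq fun c => (resO_algebraMap k h c).symm
  have h1 : formRes k h (a • D k Γ(X, U) g) =
    KaehlerDifferential.map k k Γ(X, U) Γ(X, V) (a • D k Γ(X, U) g) := rfl
  rw [h1, LinearMap.map_smul, KaehlerDifferential.map_D, ← algebraMap_smul Γ(X, V) a]
  rfl

/-- A morphism of sheaves of `𝒪_X`-modules `ω : L ⟶ Ω¹_X`. Since `Ω¹_X` is a sheaf with
`Ω¹_X(U) = Ω[Γ(X, U)⁄k]` on the affine opens `U`, and these form a basis of the topology, such
a morphism is the same as a family of `Γ(X, U)`-linear maps `L(U) → Ω[Γ(X, U)⁄k]`, `U` affine,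
compatible with restriction. -/
structure TwistedForm (L : X.Modules) where
  app (U : X.affineOpens) : Γ(L, U.1) →ₗ[Γ(X, U.1)] Ω[Γ(X, U.1)⁄k]
  app_res {U V : X.affineOpens} (h : V.1 ≤ U.1) (s : Γ(L, U.1)) :
    app V (resL L h s) = formRes k h (app U s)

/-- `X` is projective over `k`: it has a closed immersion over `k` into some `ℙⁿ_k`. -/
def IsProjectiveOver (X : Scheme.{u}) [X.Over (Spec (.of k))] : Prop :=
  letI (n : ℕ) : GradedAlgebra (MvPolynomial.homogeneousSubmodule (Fin (n + 1)) k) :=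
    MvPolynomial.gradedAlgebra
  ∃ (n : ℕ) (i : X ⟶ Proj (MvPolynomial.homogeneousSubmodule (Fin (n + 1)) k)),
    IsClosedImmersion i ∧
      i ≫ Proj.toSpecZero (MvPolynomial.homogeneousSubmodule (Fin (n + 1)) k) ≫
        Spec.map (CommRingCat.ofHom
          (algebraMap k (MvPolynomial.homogeneousSubmodule (Fin (n + 1)) k 0))) =
      X ↘ Spec (.of k)

namespace TwistedForm

variable {k} {L : X.Modules} (ω : TwistedForm k L)

/-- The image of `L(U)` in `Ω¹_X(U)`. -/
def image (U : X.affineOpens) : Submodule Γ(X, U.1) Ω[Γ(X, U.1)⁄k] := LinearMap.range (ω.app U)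

/-- `ω : L ⟶ Ω¹_X` is a foliation of codimension `1` (for `L` a line bundle): `1 ≤ dim X - 1`,
`ω ≠ 0`, `Ω¹_X / L` is torsion free, and `ω(s) ∧ dω(s) = 0` for all local sections `s` of `L`. -/
structure IsFoliation : Prop where
  isLineBundle : IsLineBundle L
  two_le_dim : 2 ≤ topologicalKrullDim X
  ne_zero : ∃ (U : X.affineOpens) (s : Γ(L, U.1)), ω.app U s ≠ 0
  torsionFree (U : X.affineOpens) :
    Module.IsTorsionFree Γ(X, U.1) (Ω[Γ(X, U.1)⁄k] ⧸ ω.image U)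
  integrable (U : X.affineOpens) (s : Γ(L, U.1)) :
    ExteriorAlgebra.ι Γ(X, U.1) (ω.app U s) *
      (extDeriv k Γ(X, U.1) (ω.app U s) : ExteriorAlgebra Γ(X, U.1) Ω[Γ(X, U.1)⁄k]) = 0

theorem formRes_mem (U : X.affineOpens) (f : Γ(X, U.1)) (e : Ω[Γ(X, U.1)⁄k])
    (he : e ∈ ω.image U) :
    formRes k (V := (X.affineBasicOpen f).1) (X.basicOpen_le f) e ∈
      ω.image (X.affineBasicOpen f) := by
  obtain ⟨s, rfl⟩ := he
  exact ⟨_, ω.app_res (U := U) (V := X.affineBasicOpen f) (X.basicOpen_le f) s⟩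

theorem exists_extend (hL : IsLineBundle L) (U : X.affineOpens) (f : Γ(X, U.1))
    (e : Ω[Γ(X, (X.affineBasicOpen f).1)⁄k]) (he : e ∈ ω.image (X.affineBasicOpen f)) :
    ∃ s ∈ Submonoid.powers f, ∃ e₀ ∈ ω.image U,
      (resO (V := (X.affineBasicOpen f).1) (X.basicOpen_le f) s) • e =
        formRes k (V := (X.affineBasicOpen f).1) (X.basicOpen_le f) e₀ := by
  obtain ⟨t, rfl⟩ := he
  obtain ⟨n, s, hs⟩ := hL.exists_extend U.2 f t
  refine ⟨f ^ n, ⟨n, rfl⟩, _, ⟨s, rfl⟩, ?_⟩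
  rw [← ω.app_res (U := U) (V := X.affineBasicOpen f) (X.basicOpen_le f) s,
    ← LinearMap.map_smul, map_pow]
  exact congrArg (ω.app (X.affineBasicOpen f)) hs.symm

section IdealSheaves

variable [Smooth (X ↘ Spec (.of k))]

theorem smooth_sections (U : X.affineOpens) : Algebra.Smooth k Γ(X, U.1) := by
  have h := Smooth.smooth_appLE (X ↘ Spec (.of k)) (isAffineOpen_top _) U.2 (le_preimage_top _ U.1)
  have h2 : (Scheme.ΓSpecIso (CommRingCat.of k)).inv.hom.Smooth :=
    RingHom.Smooth.of_bijective
      (Scheme.ΓSpecIso (CommRingCat.of k)).symm.commRingCatIsoToRingEquiv.bijective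
  exact h2.comp h

/-- The ideal sheaf `𝒥(ω)` of the singular scheme `Sing(ω)`: the image of `TX ⊗ L ⟶ 𝒪_X`,
`v ⊗ s ↦ i_v ω(s)`. -/
def singularIdealSheaf (hL : IsLineBundle L) : X.IdealSheafData where
  ideal U := singularIdeal (ω.image U)
  map_ideal_basicOpen U f := by
    have hs : Algebra.Smooth k Γ(X, U.1) := smooth_sections U
    have hft : Algebra.FinitePresentation k Γ(X, U.1) := Algebra.Smooth.finitePresentation
    have hfs : Algebra.FormallySmooth k Γ(X, U.1) := Algebra.Smooth.formallySmooth
    have hn : IsNoetherianRing Γ(X, U.1) := Algebra.FiniteType.isNoetherianRing k _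
    have hfp : Module.FinitePresentation Γ(X, U.1) Ω[Γ(X, U.1)⁄k] :=
      Module.finitePresentation_of_finite _ _
    let : Algebra Γ(X, U.1) Γ(X, (X.affineBasicOpen f).1) :=
      (resO (V := (X.affineBasicOpen f).1) (X.basicOpen_le f)).toAlgebra
    have : IsScalarTower k Γ(X, U.1) Γ(X, (X.affineBasicOpen f).1) :=
      IsScalarTower.of_algebraMap_eq fun c => (resO_algebraMap k (X.basicOpen_le f) c).symm
    have : IsLocalization.Away f Γ(X, (X.affineBasicOpen f).1) := U.2.isLocalization_basicOpen f
    exact map_singularIdeal (R := Γ(X, U.1)) (R' := Γ(X, (X.affineBasicOpen f).1))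
      (Submonoid.powers f) (E' := ω.image (X.affineBasicOpen f)) (ω.formRes_mem U f)
      (fun e he => by
        obtain ⟨s, hs, e₀, he₀, h⟩ := ω.exists_extend hL U f e he
        refine ⟨s, hs, e₀, he₀, ?_⟩
        rw [← algebraMap_smul Γ(X, (X.affineBasicOpen f).1) s e]
        exact h)

/-- The ideal sheaf `ℐ(ω)` of the closed subscheme `Per(ω)` of persistent singularities: the
annihilator of the section `[dω]` of `ℋ²(ω) ⊗ L`. -/
def persistentIdealSheaf (hL : IsLineBundle L) : X.IdealSheafData where
  ideal U := persistentIdeal (ω.image U)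
  map_ideal_basicOpen U f := by
    have hs : Algebra.Smooth k Γ(X, U.1) := smooth_sections U
    have hft : Algebra.FinitePresentation k Γ(X, U.1) := Algebra.Smooth.finitePresentation
    have hfs : Algebra.FormallySmooth k Γ(X, U.1) := Algebra.Smooth.formallySmooth
    have hn : IsNoetherianRing Γ(X, U.1) := Algebra.FiniteType.isNoetherianRing k _
    have hfp : Module.FinitePresentation Γ(X, U.1) Ω[Γ(X, U.1)⁄k] :=
      Module.finitePresentation_of_finite _ _
    let : Algebra Γ(X, U.1) Γ(X, (X.affineBasicOpen f).1) :=
      (resO (V := (X.affineBasicOpen f).1) (X.basicOpen_le f)).toAlgebra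
    have : IsScalarTower k Γ(X, U.1) Γ(X, (X.affineBasicOpen f).1) :=
      IsScalarTower.of_algebraMap_eq fun c => (resO_algebraMap k (X.basicOpen_le f) c).symm
    have : IsLocalization.Away f Γ(X, (X.affineBasicOpen f).1) := U.2.isLocalization_basicOpen f
    exact map_persistentIdeal (R := Γ(X, U.1)) (R' := Γ(X, (X.affineBasicOpen f).1))
      (Submonoid.powers f) (E' := ω.image (X.affineBasicOpen f)) (ω.formRes_mem U f)
      (fun e he => by
        obtain ⟨s, hs, e₀, he₀, h⟩ := ω.exists_extend hL U f e he
        refine ⟨s, hs, e₀, he₀, ?_⟩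
        rw [← algebraMap_smul Γ(X, (X.affineBasicOpen f).1) s e]
        exact h)

/-- The ideal sheaf `𝒦(ω)` of the closed subscheme `Kup(ω)` of Kupka singularities: the
annihilator of the section `{dω}` of `Ω²_X ⊗ 𝒪_{Sing(ω)} ⊗ L⁻¹`. -/
def kupkaIdealSheaf (hL : IsLineBundle L) : X.IdealSheafData where
  ideal U := kupkaIdeal (ω.image U)
  map_ideal_basicOpen U f := by
    have hs : Algebra.Smooth k Γ(X, U.1) := smooth_sections U
    have hft : Algebra.FinitePresentation k Γ(X, U.1) := Algebra.Smooth.finitePresentation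
    have hfs : Algebra.FormallySmooth k Γ(X, U.1) := Algebra.Smooth.formallySmooth
    have hn : IsNoetherianRing Γ(X, U.1) := Algebra.FiniteType.isNoetherianRing k _
    have hfp : Module.FinitePresentation Γ(X, U.1) Ω[Γ(X, U.1)⁄k] :=
      Module.finitePresentation_of_finite _ _
    let : Algebra Γ(X, U.1) Γ(X, (X.affineBasicOpen f).1) :=
      (resO (V := (X.affineBasicOpen f).1) (X.basicOpen_le f)).toAlgebra
    have : IsScalarTower k Γ(X, U.1) Γ(X, (X.affineBasicOpen f).1) :=
      IsScalarTower.of_algebraMap_eq fun c => (resO_algebraMap k (X.basicOpen_le f) c).symm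
    have : IsLocalization.Away f Γ(X, (X.affineBasicOpen f).1) := U.2.isLocalization_basicOpen f
    exact map_kupkaIdeal (R := Γ(X, U.1)) (R' := Γ(X, (X.affineBasicOpen f).1))
      (Submonoid.powers f) (E' := ω.image (X.affineBasicOpen f)) (ω.formRes_mem U f)
      (fun e he => by
        obtain ⟨s, hs, e₀, he₀, h⟩ := ω.exists_extend hL U f e he
        refine ⟨s, hs, e₀, he₀, ?_⟩
        rw [← algebraMap_smul Γ(X, (X.affineBasicOpen f).1) s e]
        exact h)

end IdealSheaves
end TwistedForm
end Foliations
end Foliation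

end

/-! The two ideal sheaves agree even before radicals are taken. This is local, so let `R` be the
coordinate ring of an affine open set trivialising `L` and let `w` generate the image of `L`.
Persistent is contained in Kupka because the coefficients of `w ∧ η` lie in `J = {φ(w)}`.
Conversely, for `h` in the Kupka ideal, `z = h dw` satisfies `w ∧ z = 0` and has coefficients in
`J`; the point is to find `η` with `z = w ∧ η` (`exists_eq_wedge_of_mem_smul_top`).

Contracting `w ∧ z = 0` gives `φ(w) z = w ∧ i_φ z`. Torsion freeness of `Ω¹ / Rw` shows that `w ∧ x
= 0` forces `x ∈ Rw`, and that `J` contains a regular sequence `a = φ(w)`, `b = ψ(w)`. Hence `b i_φ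
z - a i_ψ z = ρ w` for some `ρ`. If `ρ ∈ (a, b)`, regularity allows division by `a` and produces
`η`; so the class of `ρ` in `R / (a, b)`, which is killed by `J`, is the obstruction.

If that class is nonzero, some prime `p ⊇ J` is the annihilator of a multiple of it. Then the
maximal ideal of the regular local ring `R_p` is associated to `R_p / (a, b)`, so `R_p` has depth,
hence dimension, at most `2`. Any prime of `R_p` containing `a, b` is therefore maximal, and since
`J` is radical, `J R_p` is the maximal ideal, generated by two elements `f, g` of `J`. The element
`r` built from `f, g` as `ρ` was from `a, b` satisfies `r J ⊆ J²` because `z` has coefficients in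
`J`, so `r ∈ p` by Nakayama and `r` lies locally in `(f, g)`. Writing `a, b` in terms of `f, g` and
applying Cramer's rule puts `ρ` in `(a, b)` locally at `p`, a contradiction. -/

/-! ### Regularity of smooth algebras over a field. -/

-- Unramifiedness makes the maximal ideal at `q` extended from `p`, so it needs no more generators;
-- going down makes the height of `q` at least that of `p`. Hence the number of generators is at
-- most the dimension.
open IsLocalRing in
theorem isRegularLocalRing_of_etale (A : Type*) {B : Type*} [CommRing A] [CommRing B] [Algebra A B]
    [IsRegularRing A] [Algebra.Etale A B] (q : Ideal B) [q.IsPrime] :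
    IsRegularLocalRing (Localization.AtPrime q) := by
  let p := q.under A
  have : IsNoetherianRing B := Algebra.FiniteType.isNoetherianRing A B
  have : IsNoetherianRing (Localization.AtPrime q) :=
    IsLocalization.isNoetherianRing q.primeCompl _ inferInstance
  let : Algebra (Localization.AtPrime p) (Localization.AtPrime q) :=
    Localization.AtPrime.algebraOfLiesOver p q
  apply IsRegularLocalRing.of_spanFinrank_maximalIdeal_le
  have h1 := ((Algebra.isUnramifiedAt_iff_map_eq A p q).mp inferInstance).2
  rw [IsScalarTower.algebraMap_eq A (Localization.AtPrime p), ← Ideal.map_map,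
    Localization.AtPrime.map_eq_maximalIdeal] at h1
  have h2 := Ideal.spanFinrank_map_le_of_fg
    (algebraMap (Localization.AtPrime p) (Localization.AtPrime q))
    (maximalIdeal (Localization.AtPrime p)).fg_of_isNoetherianRing
  rw [h1] at h2
  have h3 := (isRegularLocalRing_iff (Localization.AtPrime p)).mp inferInstance
  have h4 : p.height ≤ q.height := by
    rw [Ideal.height_eq_height_add_of_liesOver_of_hasGoingDown p q]
    exact le_self_add
  rw [IsLocalization.AtPrime.ringKrullDim_eq_height p] at h3
  rw [IsLocalization.AtPrime.ringKrullDim_eq_height q]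
  calc _ ≤ (((maximalIdeal (Localization.AtPrime p)).spanFinrank : ℕ) : WithBot ℕ∞) := by
        exact_mod_cast h2
    _ = p.height := h3
    _ ≤ _ := by exact_mod_cast h4

/-- Near `p` a smooth algebra is étale over a polynomial ring over `k`, which is regular. -/
theorem isRegularLocalRing_of_smooth (k : Type*) {S : Type*} [Field k] [CommRing S] [Algebra k S]
    [Algebra.Smooth k S] (p : Ideal S) [p.IsPrime] :
    IsRegularLocalRing (Localization.AtPrime p) := by
  obtain ⟨f, hf, n, _, _, h⟩ := Algebra.IsSmoothAt.exists_isStandardEtale_mvPolynomial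
    (R := k) (p := p)
  have : IsRegularRing k := inferInstance
  let q := p.map (algebraMap S (Localization.Away f))
  have hd : Disjoint (Submonoid.powers f : Set S) p :=
    (Ideal.disjoint_powers_iff_notMem_of_isPrime _).mpr hf
  have : q.IsPrime := IsLocalization.isPrime_of_isPrime_disjoint (.powers f) _ _ ‹_› hd
  have hq := isRegularLocalRing_of_etale (MvPolynomial (Fin n) k) q
  have hqp : q.under S = p :=
    IsLocalization.under_map_of_isPrime_disjoint (.powers f) _ ‹_› hd
  have h := IsLocalization.isLocalization_isLocalization_atPrime_isLocalization (.powers f)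
    (Localization.AtPrime q) q
  have h' : IsLocalization p.primeCompl (Localization.AtPrime q) := by
    convert! h
    exact hqp.symm
  exact IsRegularLocalRing.of_ringEquiv
    (IsLocalization.algEquiv p.primeCompl (Localization.AtPrime q)
      (Localization.AtPrime p)).toRingEquiv

/-! ### Regular local rings: quotients by a parameter, integrality, depth. -/

namespace IsRegularLocalRing
open IsLocalRing

/-- An element outside `𝔪²` can replace one member of a minimal generating set, so the quotient
needs at least one generator fewer, while the dimension drops by at most one. Since dimension never
exceeds the number of generators, all these bounds are equalities. -/
theorem quotient_span_singleton {R : Type*} [CommRing R] [IsRegularLocalRing R] {x : R}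
    (hx : x ∈ maximalIdeal R) (hx2 : x ∉ maximalIdeal R ^ 2) :
    IsRegularLocalRing (R ⧸ Ideal.span {x}) ∧
      ringKrullDim (R ⧸ Ideal.span {x}) + 1 = ringKrullDim R := by
  have hnt : Ideal.span {x} ≠ ⊤ := by
    rw [Ne, Ideal.span_singleton_eq_top]; exact hx
  have : Nontrivial (R ⧸ Ideal.span {x}) := Ideal.Quotient.nontrivial_iff.mpr hnt
  have : IsLocalRing (R ⧸ Ideal.span {x}) :=
    IsLocalRing.of_surjective' (Ideal.Quotient.mk (Ideal.span {x})) Ideal.Quotient.mk_surjective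
  have hreg := (isRegularLocalRing_iff R).mp inferInstance
  obtain ⟨s, hs, hsm⟩ := Submodule.FG.exists_span_finset_card_eq_spanFinrank
    (maximalIdeal R).fg_of_isNoetherianRing
  classical
  obtain ⟨c, hc⟩ := Submodule.mem_span_finset'.mp (hsm ▸ hx)
  -- If every coefficient were in `𝔪`, then `x` would be in `𝔪²`.
  have hi : ∃ i, IsUnit (c i) := by
    by_contra! h
    refine hx2 ?_
    rw [← hc, pow_two]
    refine Ideal.sum_mem _ fun i _ => Ideal.mul_mem_mul (h i) ?_
    exact hsm ▸ Submodule.subset_span i.2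
  obtain ⟨i, hi⟩ := hi
  have hspan : (maximalIdeal (R ⧸ Ideal.span {x})) =
      Ideal.span ((Ideal.Quotient.mk (Ideal.span {x})) '' (s.erase i : Finset R)) := by
    rw [← Ideal.map_span]
    have h1 : maximalIdeal (R ⧸ Ideal.span {x}) =
        (maximalIdeal R).map (Ideal.Quotient.mk (Ideal.span {x})) :=
      (IsLocalRing.map_maximalIdeal_of_surjective _ Ideal.Quotient.mk_surjective).symm
    rw [h1]
    apply le_antisymm
    · rw [Ideal.map_le_iff_le_comap, ← hsm]
      refine Submodule.span_le.mpr fun y hy => ?_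
      rw [SetLike.mem_coe, Ideal.mem_comap]
      by_cases hyi : y = i
      · subst hyi
        have h2 : Ideal.Quotient.mk (Ideal.span {x}) x = 0 :=
          Ideal.Quotient.eq_zero_iff_mem.mpr (Ideal.mem_span_singleton_self x)
        have hc' : x = c i * i + ∑ j ∈ Finset.univ.erase i, c j * j :=
          hc.symm.trans (Finset.add_sum_erase _ (fun a => c a • (a : R)) (Finset.mem_univ i)).symm
        rw [congrArg (Ideal.Quotient.mk (Ideal.span {x})) hc', map_add, add_eq_zero_iff_eq_neg,
          map_mul, map_sum] at h2
        rw [← Ideal.unit_mul_mem_iff_mem _ (hi.map (Ideal.Quotient.mk (Ideal.span {x}))), h2]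
        refine neg_mem (Ideal.sum_mem _ fun j hj => ?_)
        rw [map_mul]
        refine Ideal.mul_mem_left _ _ (Ideal.mem_map_of_mem _ (Ideal.subset_span ?_))
        rw [Finset.mem_coe, Finset.mem_erase]
        exact ⟨fun h => (Finset.mem_erase.mp hj).1 (Subtype.ext h), j.2⟩
      · refine Ideal.mem_map_of_mem _ (Ideal.subset_span ?_)
        rw [Finset.mem_coe, Finset.mem_erase]
        exact ⟨hyi, hy⟩
    · refine Ideal.map_mono (Ideal.span_le.mpr fun y hy => ?_)
      exact hsm ▸ Submodule.subset_span (Finset.mem_of_mem_erase hy)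
  have hle : (maximalIdeal (R ⧸ Ideal.span {x})).spanFinrank + 1 ≤
      (maximalIdeal R).spanFinrank := by
    rw [← hs, ← Finset.card_erase_add_one i.2, hspan, add_le_add_iff_right]
    refine (Submodule.spanFinrank_span_le_ncard_of_finite
      ((Finset.finite_toSet _).image _)).trans ?_
    refine (Set.ncard_image_le (Finset.finite_toSet _)).trans ?_
    rw [Set.ncard_coe_finset]
  have hdim : ringKrullDim R ≤ ringKrullDim (R ⧸ Ideal.span {x}) + 1 := by
    have := ringKrullDim_le_ringKrullDim_quotSMulTop_succ hx
    rwa [← Submodule.ideal_span_singleton_smul, smul_eq_mul, Ideal.mul_top] at this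
  obtain ⟨d, hd⟩ : ∃ d : ℕ, ringKrullDim (R ⧸ Ideal.span {x}) = d := by
    obtain ⟨h1, h2⟩ := finiteRingKrullDim_iff_ne_bot_and_top.mp
      (inferInstance : FiniteRingKrullDim (R ⧸ Ideal.span {x}))
    lift ringKrullDim (R ⧸ Ideal.span {x}) to ℕ∞ using h1 with e
    lift e to ℕ using (by simpa using h2)
    exact ⟨e, rfl⟩
  have hup := ringKrullDim_le_spanFinrank_maximalIdeal (R ⧸ Ideal.span {x})
  rw [← hreg, hd] at hdim
  rw [hd] at hup
  have e1 : (maximalIdeal R).spanFinrank ≤ d + 1 := by exact_mod_cast hdim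
  have e2 : d ≤ (maximalIdeal (R ⧸ Ideal.span {x})).spanFinrank := by exact_mod_cast hup
  refine ⟨(isRegularLocalRing_iff _).mpr ?_, ?_⟩
  · rw [hd]; exact_mod_cast (by omega)
  · rw [hd, ← hreg]; exact_mod_cast (by omega)

/-- Induction on the number of generators of `𝔪`: a parameter `x` avoiding all minimal primes
generates a prime ideal by induction, and a minimal prime inside `(x)` must vanish. -/
theorem isDomain (R : Type*) [CommRing R] [IsRegularLocalRing R] : IsDomain R := by
  have hreg := (isRegularLocalRing_iff R).mp inferInstance
  generalize hn : (maximalIdeal R).spanFinrank = n at hreg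
  induction n generalizing R with
  | zero =>
    rw [Submodule.spanFinrank_eq_zero_iff_eq_bot (maximalIdeal R).fg_of_isNoetherianRing,
      ← IsLocalRing.isField_iff_maximalIdeal_eq] at hn
    exact hn.isDomain
  | succ n ih =>
    have hex : ∃ x ∈ maximalIdeal R, x ∉ maximalIdeal R ^ 2 ∧ ∀ P ∈ minimalPrimes R, x ∉ P := by
      by_contra! h
      have hfin := minimalPrimes.finite_of_isNoetherianRing R
      have hsub : (maximalIdeal R : Set R) ⊆
          ⋃ i ∈ insert (maximalIdeal R ^ 2) (minimalPrimes R), (i : Set R) := by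
        intro x hx
        by_cases h2 : x ∈ maximalIdeal R ^ 2
        · exact Set.mem_biUnion (Set.mem_insert _ _) h2
        · obtain ⟨P, hP, hxP⟩ := h x hx h2
          exact Set.mem_biUnion (Set.mem_insert_of_mem _ hP) hxP
      -- Prime avoidance tolerates the non-prime member `𝔪²`.
      obtain ⟨P, hP, hle⟩ := (Ideal.subset_union_prime_finite (hfin.insert _)
        (f := id) (maximalIdeal R ^ 2) (maximalIdeal R ^ 2) (by
          intro P hP hne _
          exact ((Set.mem_insert_iff.mp hP).resolve_left hne).1.1)).mp hsub
      rcases Set.mem_insert_iff.mp hP with rfl | hP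
      · have hb : maximalIdeal R = ⊥ := by
          apply Submodule.eq_bot_of_le_smul_of_le_jacobson_bot (maximalIdeal R) _
            (maximalIdeal R).fg_of_isNoetherianRing
          · rw [smul_eq_mul, ← pow_two]; exact hle
          · exact IsLocalRing.maximalIdeal_le_jacobson _
        rw [hb, Submodule.spanFinrank_bot] at hn
        omega
      · have hPp : P.IsPrime := hP.1.1
        have hPm : P = maximalIdeal R := le_antisymm (le_maximalIdeal hPp.ne_top) hle
        have h0 : P.height = 0 := Ideal.height_eq_zero_iff.mpr hP
        have h1 := maximalIdeal_height_eq_ringKrullDim (R := R)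
        rw [← hPm, h0, ← hreg] at h1
        have : (0 : ℕ) = n + 1 := by exact_mod_cast h1
        omega
    obtain ⟨x, hx, hx2, hxP⟩ := hex
    obtain ⟨hr, hd⟩ := quotient_span_singleton hx hx2
    have hd' : IsDomain (R ⧸ Ideal.span {x}) := by
      have hreg' := (isRegularLocalRing_iff (R ⧸ Ideal.span {x})).mp inferInstance
      rw [← hreg, ← hreg'] at hd
      have hn' : (maximalIdeal (R ⧸ Ideal.span {x})).spanFinrank = n := by
        have : (maximalIdeal (R ⧸ Ideal.span {x})).spanFinrank + 1 = n + 1 := by exact_mod_cast hd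
        omega
      exact ih _ hn' (hn' ▸ hreg')
    have hp : (Ideal.span {x}).IsPrime := (Ideal.Quotient.isDomain_iff_prime _).mp hd'
    obtain ⟨P, hP, hPx⟩ := Ideal.exists_minimalPrimes_le (I := ⊥) (J := Ideal.span {x}) bot_le
    have hPp : P.IsPrime := hP.1.1
    -- An element `x z` of `P` has `z ∈ P` because `x ∉ P`; so `P = x P`, and Nakayama applies.
    have hb : P = ⊥ := by
      apply Submodule.eq_bot_of_le_smul_of_le_jacobson_bot (maximalIdeal R) _
        P.fg_of_isNoetherianRing _ (IsLocalRing.maximalIdeal_le_jacobson _)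
      intro y hy
      obtain ⟨z, rfl⟩ := Ideal.mem_span_singleton.mp (hPx hy)
      exact Submodule.smul_mem_smul hx ((hPp.mem_or_mem hy).resolve_left (hxP P hP))
    rw [hb] at hPp
    exact IsDomain.of_bot_isPrime R

theorem exists_mem_maximalIdeal_notMem_sq {R : Type*} [CommRing R] [IsRegularLocalRing R]
    (h : 1 ≤ ringKrullDim R) : ∃ x ∈ maximalIdeal R, x ∉ maximalIdeal R ^ 2 := by
  by_contra! hle
  have hb : maximalIdeal R = ⊥ := by
    apply Submodule.eq_bot_of_le_smul_of_le_jacobson_bot (maximalIdeal R) _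
      (maximalIdeal R).fg_of_isNoetherianRing
    · rw [smul_eq_mul, ← pow_two]; exact hle
    · exact IsLocalRing.maximalIdeal_le_jacobson _
  rw [← (isRegularLocalRing_iff R).mp inferInstance, hb, Submodule.spanFinrank_bot] at h
  exact absurd h (by simp)

/-- A regular local ring of dimension at least `3` has depth at least `3`. -/
theorem exists_pair_of_three_le_ringKrullDim {R : Type*} [CommRing R] [IsRegularLocalRing R]
    (h : 3 ≤ ringKrullDim R) :
    ∃ x ∈ maximalIdeal R, ∃ y ∈ maximalIdeal R, x ≠ 0 ∧ (∀ u, x ∣ y * u → x ∣ u) ∧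
      ∀ z, (∀ u ∈ maximalIdeal R, u * z ∈ Ideal.span {x, y}) → z ∈ Ideal.span {x, y} := by
  have hbig {e d : WithBot ℕ∞} (n : ℕ) (h : e + 1 = d) (hd : ((n + 1 : ℕ) : WithBot ℕ∞) ≤ d) :
      (n : WithBot ℕ∞) ≤ e := by
    rw [← h, Nat.cast_add, Nat.cast_one] at hd
    exact ENat.WithBot.add_le_add_one_right_iff.mp hd
  obtain ⟨x, hx, hx2⟩ := exists_mem_maximalIdeal_notMem_sq
    (R := R) (le_trans (by norm_num) h)
  obtain ⟨hr1, hd1⟩ := quotient_span_singleton hx hx2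
  have h1 := hbig 2 hd1 (by exact_mod_cast h)
  have := isDomain (R ⧸ Ideal.span {x})
  set π := Ideal.Quotient.mk (Ideal.span {x}) with hπ
  have hπs : Function.Surjective π := Ideal.Quotient.mk_surjective
  obtain ⟨y', hy', hy2'⟩ := exists_mem_maximalIdeal_notMem_sq
    (R := R ⧸ Ideal.span {x}) (le_trans (by norm_num) h1)
  obtain ⟨hr2, hd2⟩ := quotient_span_singleton hy' hy2'
  have h2 := hbig 1 hd2 (by exact_mod_cast h1)
  have := isDomain ((R ⧸ Ideal.span {x}) ⧸ Ideal.span {y'})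
  -- A third parameter is nonzero in the domain `R / (x, y)`, so nothing nonzero there is killed by
  -- all of `𝔪`.
  obtain ⟨w', hw', hw2'⟩ := exists_mem_maximalIdeal_notMem_sq
    (R := (R ⧸ Ideal.span {x}) ⧸ Ideal.span {y'}) (by exact_mod_cast h2)
  obtain ⟨y, rfl⟩ := hπs y'
  set ρ := Ideal.Quotient.mk (Ideal.span {π y})
  obtain ⟨w₁, rfl⟩ := (Ideal.Quotient.mk_surjective : Function.Surjective ρ) w'
  obtain ⟨w, rfl⟩ := hπs w₁
  have hzero (z : R) : π z = 0 ↔ x ∣ z := by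
    rw [hπ, Ideal.Quotient.eq_zero_iff_mem, Ideal.mem_span_singleton]
  have hne {A : Type _} [CommRing A] [IsLocalRing A] {a : A} (ha : a ∉ maximalIdeal A ^ 2) :
      a ≠ 0 := fun h => ha (h ▸ zero_mem _)
  have hloc {A B : Type _} [CommRing A] [CommRing B] [IsLocalRing A] [IsLocalRing B] (f : A →+* B)
      (a : A) (h : f a ∈ maximalIdeal B) : a ∈ maximalIdeal A := fun hu => h (hu.map f)
  have hker (z : R) : ρ (π z) = 0 ↔ z ∈ Ideal.span {x, y} := by
    rw [Ideal.Quotient.eq_zero_iff_mem, Ideal.mem_span_singleton, Ideal.mem_span_pair]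
    constructor
    · rintro ⟨c, hc⟩
      obtain ⟨c, rfl⟩ := hπs c
      rw [← map_mul, ← sub_eq_zero, ← map_sub, hzero] at hc
      obtain ⟨b, hb⟩ := hc
      exact ⟨b, c, by linear_combination -hb⟩
    · rintro ⟨b, c, rfl⟩
      refine ⟨π c, ?_⟩
      rw [map_add, map_mul, map_mul, (hzero x).mpr dvd_rfl]
      ring
  refine ⟨x, hx, y, hloc π y hy', hne hx2, ?_, ?_⟩
  · intro u hu
    rw [← hzero, map_mul] at hu
    rw [← hzero]
    exact (mul_eq_zero.mp hu).resolve_left (hne hy2')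
  · intro z hz
    have := hz w (hloc π w (hloc ρ _ hw'))
    rw [← hker, map_mul, map_mul] at this
    exact (hker z).mp ((mul_eq_zero.mp this).resolve_left (hne hw2'))

end IsRegularLocalRing

/-! ### Exchanging regular sequences, and the local structure of `J` at an associated prime. -/

/-- Elements killed by `I` modulo a regular sequence can be moved to another one: given `y`, solve
`b' y ≡ b y'` modulo `a`; then `y'` is nonzero and killed by `I` modulo `(a, b')`. This makes
concrete the independence of depth from the regular sequence. -/
theorem exists_socle_mem_of_socle_mem {A : Type*} [CommRing A] {I : Ideal A} {a b b' : A}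
    (hab : ∀ u, a ∣ b * u → a ∣ u) (hab' : ∀ u, a ∣ b' * u → a ∣ u) (hb' : b' ∈ I)
    (h : ∃ y ∉ Ideal.span {a, b}, ∀ u ∈ I, u * y ∈ Ideal.span {a, b}) :
    ∃ y ∉ Ideal.span {a, b'}, ∀ u ∈ I, u * y ∈ Ideal.span {a, b'} := by
  simp only [Ideal.mem_span_pair] at h ⊢
  obtain ⟨y, hy, hu⟩ := h
  obtain ⟨w, y', hy'⟩ := hu b' hb'
  refine ⟨y', ?_, fun u hu' => ?_⟩
  · rintro ⟨v, t, rfl⟩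
    obtain ⟨c, hc⟩ := hab' (y - b * t) ⟨w + b * v, by linear_combination -hy'⟩
    exact hy ⟨c, t, by linear_combination -hc⟩
  · obtain ⟨d, c, hcd⟩ := hu u hu'
    obtain ⟨e, he⟩ := hab (u * y' - b' * c) ⟨b' * d - u * w, by linear_combination u * hy' - b' * hcd⟩
    exact ⟨e, c, by linear_combination -he⟩

theorem dvd_of_dvd_mul_swap {A : Type*} [CommRing A] [IsDomain A] {a b : A} (ha : a ≠ 0)
    (hab : ∀ u, a ∣ b * u → a ∣ u) : ∀ u, b ∣ a * u → b ∣ u := by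
  rintro u ⟨v, hv⟩
  obtain ⟨w, rfl⟩ := hab v ⟨u, hv.symm⟩
  exact ⟨w, mul_left_cancel₀ ha (by linear_combination hv)⟩

/-- Prime avoidance, for the associated primes of `A / a` and `A / a'`. -/
theorem exists_mem_regular_mod {A : Type*} [CommRing A] [IsNoetherianRing A] (I : Ideal A) (a a' : A)
    (h : ∀ y, (∀ u ∈ I, a ∣ u * y) → a ∣ y) (h' : ∀ y, (∀ u ∈ I, a' ∣ u * y) → a' ∣ y) :
    ∃ c ∈ I, (∀ u, a ∣ c * u → a ∣ u) ∧ ∀ u, a' ∣ c * u → a' ∣ u := by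
  -- The vanishing of `Hom(A / I, N)` is equivalent to `I` containing a nonzerodivisor on `N`; using
  -- a product as `N` serves both quotients with a single `c`.
  have key : Subsingleton ((A ⧸ I) →ₗ[A] ((A ⧸ Ideal.span {a}) × (A ⧸ Ideal.span {a'}))) := by
    refine subsingleton_of_forall_eq 0 fun f => ?_
    obtain ⟨y, hy⟩ := Ideal.Quotient.mk_surjective (f 1).1
    obtain ⟨y', hy'⟩ := Ideal.Quotient.mk_surjective (f 1).2
    have hf (u : A) (hu : u ∈ I) : u • f 1 = 0 := by
      rw [← map_smul, ← map_zero f]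
      congr 1
      rw [Algebra.smul_def, mul_one]
      exact Ideal.Quotient.eq_zero_iff_mem.mpr hu
    have h1 : (f 1).1 = 0 := by
      rw [← hy, Ideal.Quotient.eq_zero_iff_mem, Ideal.mem_span_singleton]
      refine h y fun u hu => ?_
      rw [← Ideal.mem_span_singleton, ← Ideal.Quotient.eq_zero_iff_mem, map_mul, hy]
      exact congrArg Prod.fst (hf u hu)
    have h2 : (f 1).2 = 0 := by
      rw [← hy', Ideal.Quotient.eq_zero_iff_mem, Ideal.mem_span_singleton]
      refine h' y' fun u hu => ?_
      rw [← Ideal.mem_span_singleton, ← Ideal.Quotient.eq_zero_iff_mem, map_mul, hy']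
      exact congrArg Prod.snd (hf u hu)
    ext
    · exact h1
    · exact h2
  obtain ⟨c, hc, hreg⟩ := IsSMulRegular.subsingleton_linearMap_iff.mp key
  rw [Ideal.annihilator_quotient] at hc
  refine ⟨c, hc, fun u hu => ?_, fun u hu => ?_⟩
  · have h0 : c • ((Ideal.Quotient.mk (Ideal.span {a}) u, 0) :
        (A ⧸ Ideal.span {a}) × (A ⧸ Ideal.span {a'})) = 0 := by
      ext
      · rw [← Ideal.mem_span_singleton, ← Ideal.Quotient.eq_zero_iff_mem] at hu
        exact hu
      · exact smul_zero _
    have := congrArg Prod.fst (hreg.right_eq_zero_of_smul h0)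
    exact Ideal.mem_span_singleton.mp (Ideal.Quotient.eq_zero_iff_mem.mp this)
  · have h0 : c • ((0, Ideal.Quotient.mk (Ideal.span {a'}) u) :
        (A ⧸ Ideal.span {a}) × (A ⧸ Ideal.span {a'})) = 0 := by
      ext
      · exact smul_zero _
      · rw [← Ideal.mem_span_singleton, ← Ideal.Quotient.eq_zero_iff_mem] at hu
        exact hu
    have := congrArg Prod.snd (hreg.right_eq_zero_of_smul h0)
    exact Ideal.mem_span_singleton.mp (Ideal.Quotient.eq_zero_iff_mem.mp this)

namespace IsRegularLocalRing
open IsLocalRing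

/-- If the maximal ideal of a regular local ring is associated to `A / (a, b)`, for a regular
sequence `a, b`, then the ring has dimension at most `2`. -/
theorem ringKrullDim_le_two_of_socle {A : Type*} [CommRing A] [IsRegularLocalRing A] {a b : A}
    (ha0 : a ≠ 0) (hbm : b ∈ maximalIdeal A)
    (hab : ∀ u, a ∣ b * u → a ∣ u)
    (h : ∃ y ∉ Ideal.span {a, b}, ∀ u ∈ maximalIdeal A, u * y ∈ Ideal.span {a, b}) :
    ringKrullDim A ≤ 2 := by
  have := isDomain A
  by_contra hd
  have hd3 : 3 ≤ ringKrullDim A := by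
    rw [← (isRegularLocalRing_iff A).mp inferInstance] at hd ⊢
    have h2 : ¬ (maximalIdeal A).spanFinrank ≤ 2 := fun h => hd (by exact_mod_cast h)
    have h3 : 3 ≤ (maximalIdeal A).spanFinrank := by omega
    exact_mod_cast h3
  obtain ⟨x, hx, y, hy, hx0, hxy, hz⟩ := exists_pair_of_three_le_ringKrullDim hd3
  -- The element `c` links the two sequences: the socle element travels along `(a, b)`, `(a, c)`,
  -- `(x, c)`, `(x, y)`, and the last quotient has none.
  obtain ⟨c, hc, hac, hxc⟩ := exists_mem_regular_mod (maximalIdeal A) a x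
    (fun z hz => hab z (hz b hbm)) (fun z hz => hxy z (hz y hy))
  have h1 := exists_socle_mem_of_socle_mem hab hac hc h
  rw [Set.pair_comm] at h1
  have h2 := exists_socle_mem_of_socle_mem (dvd_of_dvd_mul_swap ha0 hac)
    (dvd_of_dvd_mul_swap hx0 hxc) hx h1
  rw [Set.pair_comm] at h2
  obtain ⟨w, hw, hw'⟩ := exists_socle_mem_of_socle_mem hxc hxy hy h2
  exact hw (hz w hw')

/-- If `q` had height at most `1` it would be minimal over `(a)`, making its element `b` a zero
divisor modulo `a`. So `q` has height at least `2`, the most the ring allows. -/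
theorem maximalIdeal_eq_of_mem_of_ringKrullDim_le_two {A : Type*} [CommRing A]
    [IsRegularLocalRing A] (hd : ringKrullDim A ≤ 2) {a b : A} (ha0 : a ≠ 0)
    (hab : ∀ u, a ∣ b * u → a ∣ u) (q : Ideal A) [q.IsPrime] (ha : a ∈ q) (hb : b ∈ q) :
    q = maximalIdeal A := by
  have := isDomain A
  have hau : ¬ IsUnit a := fun h => Ideal.IsPrime.ne_top ‹_› (q.eq_top_of_isUnit_mem ha h)
  refine Ideal.eq_of_le_of_height_le q (le_maximalIdeal (Ideal.IsPrime.ne_top ‹_›)) ?_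
  have h1 : (maximalIdeal A).height ≤ 2 := by
    rw [← maximalIdeal_height_eq_ringKrullDim] at hd
    exact WithBot.coe_le_coe.mp hd
  refine h1.trans ?_
  by_contra! hq
  have hq1 : q.height ≤ 1 := ENat.lt_add_one_iff (by simp) |>.mp (by simpa [one_add_one_eq_two] using hq)
  have h2 := Ideal.height_span_singleton_eq_one_of_mem_nonZeroDivisors
    (mem_nonZeroDivisors_of_ne_zero ha0) hau
  have hmin : q ∈ (Ideal.span {a}).minimalPrimes :=
    Ideal.mem_minimalPrimes_of_height_le ((Ideal.span_singleton_le_iff_mem _).mpr ha) (h2 ▸ hq1)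
  obtain ⟨s, hs, hn⟩ := Ideal.exists_mul_mem_of_mem_minimalPrimes hmin hb
  rw [Ideal.mem_span_singleton] at hs hn
  exact hs (hab s hn)

end IsRegularLocalRing

/-- At an associated prime of `R / (a, b)` the local ring has dimension at most `2`, so the radical
ideal `J` becomes the maximal ideal there and two elements of `J` generate it. -/
theorem exists_local_generators {R : Type*} [CommRing R] [IsNoetherianRing R] [IsDomain R]
    {J : Ideal R} (hJ : J.IsRadical) {a b : R} (ha : a ∈ J) (hb : b ∈ J) (ha0 : a ≠ 0)
    (hab : ∀ u, a ∣ b * u → a ∣ u) {y : R} (p : Ideal R) [p.IsPrime]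
    [IsRegularLocalRing (Localization.AtPrime p)] (hJp : J ≤ p)
    (hp : ∀ x, x ∈ p ↔ x * y ∈ Ideal.span {a, b}) :
    ∃ f ∈ J, ∃ g ∈ J, ∀ x ∈ p, ∃ s ∉ p, s * x ∈ Ideal.span {f, g} := by
  let A := Localization.AtPrime p
  let i := algebraMap R A
  have hinj : Function.Injective i := IsLocalization.injective A p.primeCompl_le_nonZeroDivisors
  have hmem (x : R) : i x ∈ IsLocalRing.maximalIdeal A ↔ x ∈ p :=
    IsLocalization.AtPrime.to_map_mem_maximal_iff A p x
  have hunit {s : R} (hs : s ∉ p) : IsUnit (i s) := IsLocalization.map_units A (⟨s, hs⟩ : p.primeCompl)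
  have hreg : ∀ u, i a ∣ i b * u → i a ∣ u := by
    rintro u ⟨v, hv⟩
    obtain ⟨⟨u₀, s⟩, hu⟩ := IsLocalization.surj p.primeCompl u
    obtain ⟨⟨v₀, t⟩, hv₀⟩ := IsLocalization.surj p.primeCompl v
    obtain ⟨c, hc⟩ := hab (u₀ * t) ⟨v₀ * s, hinj (by
      simp only [map_mul]
      simp only at hu hv₀
      rw [← hu, ← hv₀]
      linear_combination i s * i t * hv)⟩
    rw [← (hunit s.2).dvd_mul_right, ← (hunit t.2).dvd_mul_right]
    refine ⟨i c, ?_⟩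
    rw [← map_mul, ← hc, map_mul, ← hu]
  have hQ (Q : Ideal R) (x : R) : i x ∈ Q.map i ↔ ∃ s ∉ p, s * x ∈ Q :=
    IsLocalization.algebraMap_mem_map_algebraMap_iff p.primeCompl A Q x
  have hspan (f g : R) : (Ideal.span {f, g}).map i = Ideal.span {i f, i g} := by
    rw [Ideal.map_span, Set.image_pair]
  have hbad : ∃ y ∉ Ideal.span {i a, i b}, ∀ u ∈ IsLocalRing.maximalIdeal A,
      u * y ∈ Ideal.span {i a, i b} := by
    refine ⟨i y, ?_, fun u hu => ?_⟩
    · rw [← hspan, hQ]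
      rintro ⟨s, hs, hsy⟩
      exact hs ((hp s).mpr hsy)
    · obtain ⟨⟨u₀, s⟩, hu₀⟩ := IsLocalization.surj p.primeCompl u
      rw [← Ideal.unit_mul_mem_iff_mem _ (hunit s.2), ← mul_assoc, mul_comm _ u, hu₀, ← hspan,
        ← map_mul]
      refine Ideal.mem_map_of_mem _ ((hp _).mp ((hmem u₀).mp ?_))
      rw [← hu₀]
      exact Ideal.mul_mem_right _ _ hu
  have ha0' : i a ≠ 0 := by rwa [Ne, map_eq_zero_iff i hinj]
  have hdim := IsRegularLocalRing.ringKrullDim_le_two_of_socle ha0' ((hmem b).mpr (hJp hb))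
    hreg hbad
  -- The extension of `J` is radical, and the only prime containing it, hence `a` and `b`, is the
  -- maximal ideal.
  have hJm : J.map i = IsLocalRing.maximalIdeal A := by
    have hrad : (J.map i).IsRadical := by
      have := IsLocalization.map_radical p.primeCompl A J
      rw [hJ.radical] at this
      rw [this]
      exact Ideal.radical_isRadical _
    have hle : J.map i ≤ IsLocalRing.maximalIdeal A :=
      Ideal.map_le_iff_le_comap.mpr fun x hx => (hmem x).mpr (hJp hx)
    refine le_antisymm hle ?_
    rw [← hrad.radical, Ideal.radical_eq_sInf]
    refine le_sInf ?_
    rintro q ⟨hq, hqp⟩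
    rw [IsRegularLocalRing.maximalIdeal_eq_of_mem_of_ringKrullDim_le_two hdim ha0' hreg q
      (hq (Ideal.mem_map_of_mem _ ha)) (hq (Ideal.mem_map_of_mem _ hb))]
  have hgen : ∃ f g : A, Ideal.span {f, g} = IsLocalRing.maximalIdeal A := by
    rw [← (isRegularLocalRing_iff A).mp inferInstance] at hdim
    have h2 : (IsLocalRing.maximalIdeal A).spanFinrank ≤ 2 := by exact_mod_cast hdim
    obtain ⟨s, hs, hsm⟩ := Submodule.FG.exists_span_finset_card_eq_spanFinrank
      (IsLocalRing.maximalIdeal A).fg_of_isNoetherianRing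
    rw [← hs] at h2
    -- With fewer than two generators, the pair is padded by `0` or by repetition.
    have hs2 : ∃ f g, (s : Set A) ⊆ {f, g} ∧ {f, g} ⊆ insert 0 (s : Set A) := by
      classical
      interval_cases h : s.card
      · exact ⟨0, 0, by simp [Finset.card_eq_zero.mp h], by simp⟩
      · obtain ⟨f, rfl⟩ := Finset.card_eq_one.mp h
        exact ⟨f, f, by simp, by simp⟩
      · obtain ⟨f, g, -, rfl⟩ := Finset.card_eq_two.mp h
        exact ⟨f, g, by simp, by simp⟩
    obtain ⟨f, g, h1, h2⟩ := hs2
    refine ⟨f, g, le_antisymm ?_ (hsm ▸ Submodule.span_mono h1)⟩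
    rw [← hsm]
    refine (Submodule.span_mono h2).trans ?_
    rw [Submodule.span_insert_zero]
  have hlift (f : A) (hf : f ∈ IsLocalRing.maximalIdeal A) :
      ∃ f₀ ∈ J, ∃ s : A, IsUnit s ∧ f * s = i f₀ := by
    rw [← hJm, IsLocalization.mem_map_algebraMap_iff p.primeCompl] at hf
    obtain ⟨⟨f₀, s⟩, h⟩ := hf
    exact ⟨f₀, f₀.2, i s, hunit s.2, h⟩
  obtain ⟨f, g, hfg⟩ := hgen
  obtain ⟨f₀, hf₀, s, hs, hfs⟩ := hlift f (hfg ▸ Ideal.subset_span (by simp))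
  obtain ⟨g₀, hg₀, t, ht, hgt⟩ := hlift g (hfg ▸ Ideal.subset_span (by simp))
  refine ⟨f₀, hf₀, g₀, hg₀, fun x hx => ?_⟩
  rw [← hQ, hspan, ← hfs, ← hgt]
  have hx' := (hmem x).mpr hx
  rw [← hfg, Ideal.mem_span_pair] at hx'
  obtain ⟨c, d, hcd⟩ := hx'
  obtain ⟨s, rfl⟩ := hs
  obtain ⟨t, rfl⟩ := ht
  rw [Ideal.mem_span_pair]
  refine ⟨c * ↑s⁻¹, d * ↑t⁻¹, ?_⟩
  rw [← hcd]
  linear_combination (c * f) * s.inv_mul + (d * g) * t.inv_mul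

/-- Were `r` a unit at `p`, then `J_p = J_p²`, so `J_p = 0` by Nakayama and `J = 0` because `R`
embeds in its localization. -/
theorem mem_of_forall_mul_mem_sq {R : Type*} [CommRing R] [IsNoetherianRing R] [IsDomain R]
    {J p : Ideal R} [p.IsPrime] (hJp : J ≤ p) (hJ0 : J ≠ ⊥) {r : R}
    (hr : ∀ x ∈ J, r * x ∈ J ^ 2) : r ∈ p := by
  by_contra hrp
  let A := Localization.AtPrime p
  have hinj : Function.Injective (algebraMap R A) :=
    IsLocalization.injective A p.primeCompl_le_nonZeroDivisors
  have hu : IsUnit (algebraMap R A r) := IsLocalization.map_units A (⟨r, hrp⟩ : p.primeCompl)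
  have hb : J.map (algebraMap R A) = ⊥ := by
    apply Submodule.eq_bot_of_le_smul_of_le_jacobson_bot (J.map (algebraMap R A)) _
      (J.map (algebraMap R A)).fg_of_isNoetherianRing
    · rw [smul_eq_mul, ← pow_two, ← Ideal.map_pow, Ideal.map_le_iff_le_comap]
      intro x hx
      rw [Ideal.mem_comap, ← Ideal.unit_mul_mem_iff_mem _ hu, ← map_mul]
      exact Ideal.mem_map_of_mem _ (hr x hx)
    · refine le_trans ?_ (IsLocalRing.maximalIdeal_le_jacobson _)
      rw [Ideal.map_le_iff_le_comap]
      exact fun x hx => (IsLocalization.AtPrime.to_map_mem_maximal_iff A p x).mpr (hJp hx)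
  exact hJ0 ((Ideal.map_eq_bot_iff_of_injective hinj).mp hb)

namespace Foliation
-- Taking an associated prime of the cyclic module generated by `r` in `R / Q`, rather than of `R /
-- Q` itself, ensures that the witness is a multiple of `r`.
theorem exists_prime_eq_colon {R : Type*} [CommRing R] [IsNoetherianRing R] (Q : Ideal R) {r : R} (hr : r ∉ Q) :
    ∃ (p : Ideal R) (c : R), p.IsPrime ∧ ∀ x, x ∈ p ↔ x * (c * r) ∈ Q := by
  let N := Submodule.span R {Ideal.Quotient.mk Q r}
  have : Nontrivial N := by
    rw [Submodule.nontrivial_iff_ne_bot, Ne, Submodule.span_singleton_eq_bot,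
      Ideal.Quotient.eq_zero_iff_mem]
    exact hr
  obtain ⟨p, hp⟩ := associatedPrimes.nonempty R N
  obtain ⟨hprime, ⟨x, hxN⟩, hx⟩ := isAssociatedPrime_iff.mp hp
  obtain ⟨c, rfl⟩ := Submodule.mem_span_singleton.mp hxN
  refine ⟨p, c, hprime, fun y => ?_⟩
  rw [hx, Submodule.mem_colon_singleton, Submodule.mem_bot, ← Ideal.Quotient.eq_zero_iff_mem,
    ← Subtype.coe_inj]
  rfl

/-! ### Contraction of `2`-vectors by linear forms. -/

section Contraction
variable {R M : Type*} [CommRing R] [AddCommGroup M] [Module R M]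

/-- The contraction `⋀² M → M` by a linear form `φ`, with `a ∧ b ↦ φ(a) b - φ(b) a`. -/
noncomputable def contract (φ : M →ₗ[R] R) : ⋀[R]^2 M →ₗ[R] M :=
  ofBilin (LinearMap.mk₂ R (fun a b => φ a • b - φ b • a)
    (by intros; simp only [map_add]; module)
    (by intros; simp only [map_smul, smul_eq_mul]; module)
    (by intros; simp only [map_add]; module)
    (by intros; simp only [map_smul, smul_eq_mul]; module)) (by intro x; simp)

theorem contract_wedge (φ : M →ₗ[R] R) (a b : M) :
    contract φ (wedge a b) = φ a • b - φ b • a := ofBilin_wedge _ _ _ _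

theorem ext_wedge {N : Type*} [AddCommGroup N] [Module R N] {f g : ⋀[R]^2 M →ₗ[R] N}
    (h : ∀ a b, f (wedge a b) = g (wedge a b)) : f = g :=
  LinearMap.ext_on_range (wedge_span_top M) fun x => h x.1 x.2

theorem contract_add (φ ψ : M →ₗ[R] R) (z : ⋀[R]^2 M) :
    contract (φ + ψ) z = contract φ z + contract ψ z := by
  rw [← LinearMap.add_apply]
  congr 1
  refine ext_wedge fun a b => ?_
  simp only [LinearMap.add_apply, contract_wedge]
  module

theorem contract_smul (c : R) (φ : M →ₗ[R] R) (z : ⋀[R]^2 M) :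
    contract (c • φ) z = c • contract φ z := by
  rw [← LinearMap.smul_apply]
  congr 1
  refine ext_wedge fun a b => ?_
  simp only [LinearMap.smul_apply, contract_wedge, smul_eq_mul]
  module

theorem coe_wedge (a b : M) : ((wedge (R := R) a b : ⋀[R]^2 M) : ExteriorAlgebra R M) =
    ExteriorAlgebra.ι R a * ExteriorAlgebra.ι R b := by
  rw [wedge_apply, exteriorPower.ιMulti_apply_coe, ExteriorAlgebra.ιMulti_apply]
  simp

/-- The exterior algebra is the Clifford algebra of the zero form; this comparison gives access to
its antiderivation rule for products such as `w ∧ z`. -/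
theorem contractLeft_coe (φ : M →ₗ[R] R) (z : ⋀[R]^2 M) :
    CliffordAlgebra.contractLeft (Q := (0 : QuadraticForm R M)) φ (z : ExteriorAlgebra R M) =
      ExteriorAlgebra.ι R (contract φ z) := by
  have h : (CliffordAlgebra.contractLeft (Q := (0 : QuadraticForm R M)) φ) ∘ₗ
      (⋀[R]^2 M).subtype = (ExteriorAlgebra.ι R) ∘ₗ contract φ := by
    refine ext_wedge fun a b => ?_
    rw [LinearMap.comp_apply, LinearMap.comp_apply, contract_wedge, Submodule.subtype_apply,
      coe_wedge, CliffordAlgebra.contractLeft_ι_mul, CliffordAlgebra.contractLeft_ι, map_sub,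
      map_smul, map_smul, ← Algebra.commutes, ← Algebra.smul_def]
  exact LinearMap.congr_fun h z

/-- Contract `w ∧ z = 0`: the antiderivation rule gives `0 = φ(w) z - w ∧ i_φ z`. So the values
`φ(w)` annihilate the second Koszul cohomology. -/
theorem smul_eq_wedge_contract {w : M} {z : ⋀[R]^2 M}
    (h : ExteriorAlgebra.ι R w * (z : ExteriorAlgebra R M) = 0) (φ : M →ₗ[R] R) :
    φ w • z = wedge w (contract φ z) := by
  have h1 := CliffordAlgebra.contractLeft_ι_mul (Q := (0 : QuadraticForm R M)) φ w
    (z : ExteriorAlgebra R M)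
  have h2 : CliffordAlgebra.contractLeft (Q := (0 : QuadraticForm R M)) φ
      (CliffordAlgebra.ι (0 : QuadraticForm R M) w * (z : ExteriorAlgebra R M)) = 0 := by
    rw [← map_zero (CliffordAlgebra.contractLeft (Q := (0 : QuadraticForm R M)) φ)]
    exact congrArg _ h
  rw [h2, contractLeft_coe] at h1
  apply Subtype.ext
  rw [coe_wedge]
  exact (sub_eq_zero.mp h1.symm)

theorem apply_contract_mem {J : Ideal R} {z : ⋀[R]^2 M}
    (hz : z ∈ J • (⊤ : Submodule R (⋀[R]^2 M))) (θ φ : M →ₗ[R] R) : θ (contract φ z) ∈ J := by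
  refine Submodule.smul_induction_on hz ?_ ?_
  · intro r hr x _
    rw [map_smul, map_smul]
    exact J.mul_mem_right _ hr
  · intro x y hx hy
    rw [map_add, map_add]
    exact J.add_mem hx hy

end Contraction

/-! ### Duality for finite projective modules and division by `w`. -/

section Projective
variable {R M : Type*} [CommRing R] [AddCommGroup M] [Module R M]
  [Module.Finite R M] [Module.Projective R M]

variable (R M) in
theorem exists_dual_basis : ∃ (n : ℕ) (e : Fin n → M) (φ : Fin n → M →ₗ[R] R),
    ∀ x, x = ∑ i, φ i x • e i := by
  obtain ⟨n, f, g, -, -, hfg⟩ := Module.Finite.exists_comp_eq_id_of_projective R M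
  refine ⟨n, fun i => f (Pi.single i 1), fun i => LinearMap.proj i ∘ₗ g, fun x => ?_⟩
  conv_lhs => rw [← LinearMap.id_apply (R := R) x, ← hfg, LinearMap.comp_apply,
    pi_eq_sum_univ' (g x), map_sum]
  exact Finset.sum_congr rfl fun i _ => map_smul _ _ _

theorem exists_eq_smul_of_forall_dvd {a : R} {x : M} (h : ∀ φ : M →ₗ[R] R, a ∣ φ x) :
    ∃ y, x = a • y := by
  obtain ⟨n, e, φ, hx⟩ := exists_dual_basis R M
  choose c hc using fun i => h (φ i)
  refine ⟨∑ i, c i • e i, ?_⟩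
  rw [Finset.smul_sum]
  conv_lhs => rw [hx x]
  exact Finset.sum_congr rfl fun i _ => by rw [hc, mul_smul]

theorem eq_zero_of_forall_dual {x : M} (h : ∀ φ : M →ₗ[R] R, φ x = 0) : x = 0 := by
  obtain ⟨y, hy⟩ := exists_eq_smul_of_forall_dvd (a := (0 : R)) (x := x) fun φ => by rw [h φ]
  rw [hy, zero_smul]

/-- Euler's identity `∑ eᵢ ∧ i_{φᵢ} u = 2 u` for a dual basis: contractions detect `2`-vectors up to
the factor `2`. -/
theorem two_smul_eq_zero_of_contract_eq_zero {u : ⋀[R]^2 M}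
    (h : ∀ φ : M →ₗ[R] R, contract φ u = 0) : (2 : R) • u = 0 := by
  obtain ⟨n, e, φ, hx⟩ := exists_dual_basis R M
  have key : (2 : R) • LinearMap.id = ∑ i, (wedge (R := R) (e i)) ∘ₗ contract (φ i) := by
    refine ext_wedge fun a b => ?_
    simp only [LinearMap.smul_apply, LinearMap.id_apply, LinearMap.sum_apply,
      LinearMap.comp_apply, contract_wedge, map_sub, map_smul, Finset.sum_sub_distrib]
    have h1 : ∑ i, φ i a • wedge (R := R) (e i) b = wedge a b := by
      conv_rhs => rw [hx a]
      simp only [map_sum, map_smul, LinearMap.sum_apply, LinearMap.smul_apply]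
    have h2 : ∑ i, φ i b • wedge (R := R) (e i) a = wedge b a := by
      conv_rhs => rw [hx b]
      simp only [map_sum, map_smul, LinearMap.sum_apply, LinearMap.smul_apply]
    rw [h1, h2, wedge_swap b a]
    module
  have := LinearMap.congr_fun key u
  simpa [h] using this

/-- Contraction turns `w ∧ x = 0` into `φ(w) x = φ(x) w`; torsion freeness modulo `w` then removes
the nonzero factor `φ(w)`. -/
theorem exists_eq_smul_of_wedge_eq_zero {w : M} (hw : w ≠ 0)
    (htf : ∀ (a : R) (x : M), a ≠ 0 → a • x ∈ Submodule.span R {w} → x ∈ Submodule.span R {w})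
    {x : M} (hx : wedge (R := R) w x = 0) : ∃ c : R, x = c • w := by
  obtain ⟨φ, hφ⟩ : ∃ φ : M →ₗ[R] R, φ w ≠ 0 := by
    by_contra! h
    exact hw (eq_zero_of_forall_dual h)
  have h := congrArg (contract φ) hx
  rw [contract_wedge, map_zero, sub_eq_zero] at h
  obtain ⟨c, hc⟩ := Submodule.mem_span_singleton.mp
    (htf _ x hφ (h ▸ Submodule.smul_mem _ _ (Submodule.mem_span_singleton_self w)))
  exact ⟨c, hc.symm⟩

variable [IsDomain R]

theorem eq_zero_of_smul_eq_zero {a : R} (ha : a ≠ 0) {x : M} (h : a • x = 0) : x = 0 :=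
  eq_zero_of_forall_dual (R := R) fun φ => by
    have := congrArg φ h
    rw [map_smul, map_zero, smul_eq_mul] at this
    exact (mul_eq_zero.mp this).resolve_left ha

theorem wedge_eq_zero_of_smul_eq_zero (h2 : IsUnit (2 : R)) {a : R} (ha : a ≠ 0) {u : ⋀[R]^2 M}
    (h : a • u = 0) : u = 0 := by
  have := two_smul_eq_zero_of_contract_eq_zero (u := u) fun φ => by
    refine eq_zero_of_smul_eq_zero ha ?_
    rw [← map_smul, h, map_zero]
  exact h2.smul_eq_zero.mp this

variable [IsNoetherianRing R]

/-- Unmixedness of the second Koszul cohomology of `w`, in the form needed for the comparison of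
persistent and Kupka singularities. -/
theorem exists_eq_wedge_of_mem_smul_top
    (hreg : ∀ (p : Ideal R) [p.IsPrime], IsRegularLocalRing (Localization.AtPrime p))
    (h2 : IsUnit (2 : R)) {w : M} (hw : w ≠ 0)
    (htf : ∀ (a : R) (x : M), a ≠ 0 → a • x ∈ Submodule.span R {w} → x ∈ Submodule.span R {w})
    {J : Ideal R} (hJ : J.IsRadical) (hJw : ∀ x, x ∈ J ↔ ∃ φ : M →ₗ[R] R, φ w = x)
    {z : ⋀[R]^2 M} (hwz : ExteriorAlgebra.ι R w * (z : ExteriorAlgebra R M) = 0)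
    (hz : z ∈ J • (⊤ : Submodule R (⋀[R]^2 M))) : ∃ η, z = wedge w η := by
  obtain ⟨φ, hφ⟩ : ∃ φ : M →ₗ[R] R, φ w ≠ 0 := by
    by_contra! h
    exact hw (eq_zero_of_forall_dual h)
  have hcancel {c d : R} (h : c • w = d • w) : c = d := by
    by_contra hcd
    exact hw (eq_zero_of_smul_eq_zero (sub_ne_zero.mpr hcd) (by rw [sub_smul, h, sub_self]))
  have hexact {x : M} (hx : wedge (R := R) w x = 0) : ∃ c : R, x = c • w :=
    exists_eq_smul_of_wedge_eq_zero hw htf hx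
  have hc (φ : M →ₗ[R] R) : wedge (R := R) w (contract φ z) = φ w • z :=
    (smul_eq_wedge_contract hwz φ).symm
  -- `J` has grade at least `2`: all coordinates of `y w` are divisible by `φ(w)`, so `y w = φ(w)
  -- x`, and `x` is a multiple of `w` by torsion freeness.
  have hdvd (y : R) (hy : ∀ u ∈ J, φ w ∣ u * y) : φ w ∣ y := by
    obtain ⟨x, hx⟩ := exists_eq_smul_of_forall_dvd (a := φ w) (x := y • w) (fun ψ => by
      rw [map_smul, smul_eq_mul, mul_comm]
      exact hy _ ((hJw _).mpr ⟨ψ, rfl⟩))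
    obtain ⟨c, rfl⟩ := Submodule.mem_span_singleton.mp (htf _ x hφ
      (hx ▸ Submodule.smul_mem _ _ (Submodule.mem_span_singleton_self w)))
    exact ⟨c, hcancel (by rw [hx, mul_smul])⟩
  obtain ⟨b, hb, hab, -⟩ := exists_mem_regular_mod J (φ w) (φ w) hdvd hdvd
  obtain ⟨ψ, rfl⟩ := (hJw b).mp hb
  -- Both terms wedge with `w` to `φ₁(w) φ₂(w) z`, so their difference is a multiple of `w`.
  have hρ (φ₁ φ₂ : M →ₗ[R] R) :
      ∃ ρ : R, φ₂ w • contract φ₁ z - φ₁ w • contract φ₂ z = ρ • w := by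
    apply hexact
    rw [map_sub, map_smul, map_smul, hc, hc, smul_comm, sub_self]
  obtain ⟨ρ, hρ₀⟩ := hρ φ ψ
  by_cases hmem : ρ ∈ Ideal.span {φ w, ψ w}
  · obtain ⟨t, s, hts⟩ := Ideal.mem_span_pair.mp hmem
    -- The obstruction vanishes: subtracting `s w` does not change the wedge with `w`, and makes
    -- `i_φ z` divisible by `φ(w)`; the quotient is `η`.
    have h1 : ψ w • (contract φ z - s • w) = φ w • (contract ψ z + t • w) := by
      rw [← hts] at hρ₀
      rw [← sub_eq_zero] at hρ₀ ⊢
      rw [← hρ₀]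
      module
    obtain ⟨η, hη⟩ := exists_eq_smul_of_forall_dvd (a := φ w) (x := contract φ z - s • w)
      (fun θ => hab _ ⟨θ (contract ψ z + t • w), by
        rw [← smul_eq_mul, ← map_smul, h1, map_smul, smul_eq_mul]⟩)
    refine ⟨η, sub_eq_zero.mp (wedge_eq_zero_of_smul_eq_zero h2 hφ ?_)⟩
    rw [smul_sub, ← hc, ← map_smul, ← hη, map_sub, map_smul, wedge_self, smul_zero, sub_zero,
      sub_self]
  · exfalso
    obtain ⟨p, c, hp, hpQ⟩ := exists_prime_eq_colon _ hmem
    have hnot {s : R} (hs : s * ρ ∈ Ideal.span {φ w, ψ w}) : s ∈ p := by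
      rw [hpQ, mul_left_comm]
      exact Ideal.mul_mem_left _ _ hs
    -- Evaluating the relation for `ρ` at `θ` puts `θ(w) ρ` in `(φ(w), ψ(w))`.
    have hJp : J ≤ p := by
      intro x hx
      obtain ⟨θ, rfl⟩ := (hJw x).mp hx
      apply hnot
      rw [Ideal.mem_span_pair]
      have := congrArg θ hρ₀
      simp only [map_sub, map_smul, smul_eq_mul] at this
      exact ⟨-θ (contract ψ z), θ (contract φ z), by linear_combination this⟩
    have := hreg p
    obtain ⟨f, hf, g, hg, hfg⟩ := exists_local_generators hJ ((hJw _).mpr ⟨φ, rfl⟩) hb hφ hab p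
      hJp hpQ
    obtain ⟨φ', rfl⟩ := (hJw f).mp hf
    obtain ⟨ψ', rfl⟩ := (hJw g).mp hg
    obtain ⟨r, hr⟩ := hρ φ' ψ'
    -- Here the coefficients of `z` lying in `J` matter: `r θ(w)` is a combination of products of
    -- `f, g ∈ J` with values of contractions of `z`, also in `J`.
    have hrp : r ∈ p := by
      refine mem_of_forall_mul_mem_sq hJp (fun h => hφ ?_) (r := r) fun x hx => ?_
      · have : φ w ∈ J := (hJw _).mpr ⟨φ, rfl⟩
        rwa [h] at this
      · obtain ⟨θ, rfl⟩ := (hJw x).mp hx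
        rw [← smul_eq_mul, ← map_smul, ← hr, map_sub, map_smul, map_smul, pow_two]
        exact sub_mem (Ideal.mul_mem_mul hg (apply_contract_mem hz _ _))
          (Ideal.mul_mem_mul hf (apply_contract_mem hz _ _))
    obtain ⟨s₁, hs₁, h₁⟩ := hfg _ (hJp ((hJw _).mpr ⟨φ, rfl⟩))
    obtain ⟨s₂, hs₂, h₂⟩ := hfg _ (hJp hb)
    obtain ⟨s₃, hs₃, h₃⟩ := hfg _ hrp
    obtain ⟨α, β, h₁⟩ := Ideal.mem_span_pair.mp h₁
    obtain ⟨γ, δ, h₂⟩ := Ideal.mem_span_pair.mp h₂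
    obtain ⟨u, v, h₃⟩ := Ideal.mem_span_pair.mp h₃
    -- The form `s θ - a φ' - b ψ'` kills `w`, so its contraction with `z` wedges to zero with `w`.
    have hlin (s : R) (θ : M →ₗ[R] R) (a b : R) (h : a * φ' w + b * ψ' w = s * θ w) :
        ∃ μ : R, s • contract θ z = a • contract φ' z + b • contract ψ' z + μ • w := by
      obtain ⟨μ, hμ⟩ := hexact (x := contract (s • θ + (-a) • φ' + (-b) • ψ') z) (by
        rw [hc]
        simp only [LinearMap.add_apply, LinearMap.smul_apply, smul_eq_mul]
        rw [← h]
        convert zero_smul R z using 2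
        ring)
      refine ⟨μ, ?_⟩
      rw [← hμ]
      simp only [contract_add, contract_smul]
      module
    obtain ⟨μ, hμ⟩ := hlin s₁ φ α β h₁
    obtain ⟨ν, hν⟩ := hlin s₂ ψ γ δ h₂
    -- Change of generators multiplies the obstruction by the determinant, modulo `(φ(w), ψ(w))`.
    have key : s₁ * s₂ * ρ = (α * δ - β * γ) * r + (s₂ * ψ w) * μ - (s₁ * φ w) * ν := by
      apply hcancel
      calc (s₁ * s₂ * ρ) • w = (s₁ * s₂) • (ψ w • contract φ z - φ w • contract ψ z) := by
            rw [hρ₀, mul_smul]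
        _ = (s₂ * ψ w) • (s₁ • contract φ z) - (s₁ * φ w) • (s₂ • contract ψ z) := by module
        _ = (α * δ - β * γ) • (ψ' w • contract φ' z - φ' w • contract ψ' z) +
            ((s₂ * ψ w) * μ - (s₁ * φ w) * ν) • w := by
            rw [hμ, hν, ← h₁, ← h₂]; module
        _ = _ := by rw [hr]; module
    have hs : s₁ * s₂ * s₃ ∈ p := by
      apply hnot
      rw [Ideal.mem_span_pair]
      -- Cramer's rule writes the determinant times `φ'(w)` and `ψ'(w)`, hence times `s₃ r`, through
      -- `φ(w)` and `ψ(w)`.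
      refine ⟨u * δ * s₁ - v * γ * s₁ - s₁ * ν * s₃, v * α * s₂ - u * β * s₂ + s₂ * μ * s₃, ?_⟩
      linear_combination -s₃ * key + (α * δ - β * γ) * h₃ + (v * γ - u * δ) * h₁ +
        (u * β - v * α) * h₂
    rcases hp.mem_or_mem hs with h | h
    · rcases hp.mem_or_mem h with h | h
      · exact hs₁ h
      · exact hs₂ h
    · exact hs₃ h

end Projective
end Foliation

/-! ### From modules to foliations. -/

namespace Foliation
open KaehlerDifferential

/-- For a cyclic module the contractions already form an ideal, the image of evaluation at `w`, so
no span is needed. -/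
theorem mem_singularIdeal_span_singleton {k R : Type*} [CommRing k] [CommRing R] [Algebra k R]
    {w : Ω[R⁄k]} {x : R} :
    x ∈ singularIdeal (Submodule.span R {w}) ↔ ∃ φ : Ω[R⁄k] →ₗ[R] R, φ w = x := by
  constructor
  · intro hx
    have hle : singularIdeal (Submodule.span R {w}) ≤
        LinearMap.range (Module.Dual.eval R Ω[R⁄k] w) := by
      rw [singularIdeal, Ideal.span_le]
      rintro _ ⟨v, e, he, rfl⟩
      obtain ⟨c, rfl⟩ := Submodule.mem_span_singleton.mp he
      exact ⟨c • v.liftKaehlerDifferential, by simp⟩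
    obtain ⟨φ, hφ⟩ := hle hx
    exact ⟨φ, hφ⟩
  · rintro ⟨φ, rfl⟩
    exact dual_apply_mem_singularIdeal φ (Submodule.mem_span_singleton_self w)

theorem persistentIdeal_le_kupkaIdeal {k R : Type*} [CommRing k] [CommRing R] [Algebra k R]
    [Module.Finite R Ω[R⁄k]] [Module.Projective R Ω[R⁄k]] (E : Submodule R Ω[R⁄k]) :
    persistentIdeal E ≤ kupkaIdeal E := by
  intro h hh e he
  refine Submodule.span_le.mpr ?_ (hh e he)
  rintro _ ⟨e, he, η, rfl⟩
  exact wedge_mem_singularIdeal_smul_top he η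

theorem persistentIdeal_eq_kupkaIdeal {k R : Type*} [Field k] [CharZero k] [CommRing R] [IsDomain R]
    [Algebra k R] [Algebra.Smooth k R] {w : Ω[R⁄k]}
    (htf : Module.IsTorsionFree R (Ω[R⁄k] ⧸ Submodule.span R {w}))
    (hint : ExteriorAlgebra.ι R w * (extDeriv k R w : ExteriorAlgebra R Ω[R⁄k]) = 0)
    (hJ : (singularIdeal (Submodule.span R {w})).IsRadical) :
    persistentIdeal (Submodule.span R {w}) = kupkaIdeal (Submodule.span R {w}) := by
  have : IsNoetherianRing R := Algebra.FiniteType.isNoetherianRing k _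
  refine le_antisymm (persistentIdeal_le_kupkaIdeal _) fun h hh => ?_
  have hw := Submodule.mem_span_singleton_self (R := R) w
  -- The generator suffices: in `d(r w) = dr ∧ w + r dw` the first term is already in `E ∧ Ω¹`.
  suffices hη : ∃ η, h • extDeriv k R w = wedge w η by
    obtain ⟨η, hη⟩ := hη
    intro e he
    obtain ⟨r, rfl⟩ := Submodule.mem_span_singleton.mp he
    rw [extDeriv_smul, smul_add, smul_comm h r, hη, wedge_swap, smul_neg]
    exact add_mem (neg_mem (Submodule.smul_mem _ _ (wedge_mem_wedgeForms hw _)))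
      (Submodule.smul_mem _ _ (wedge_mem_wedgeForms hw _))
  by_cases hw0 : w = 0
  · exact ⟨0, by simp [hw0]⟩
  refine exists_eq_wedge_of_mem_smul_top (fun p _ => isRegularLocalRing_of_smooth k p) ?_ hw0 ?_ hJ
    (fun x => mem_singularIdeal_span_singleton) ?_ (hh w hw)
  -- Characteristic zero enters through the invertibility of `2`.
  · exact map_ofNat (algebraMap k R) 2 ▸ (IsUnit.mk0 (2 : k) two_ne_zero).map (algebraMap k R)
  · intro a x ha hx
    rw [← Submodule.Quotient.mk_eq_zero] at hx ⊢
    rw [Submodule.Quotient.mk_smul] at hx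
    exact (smul_eq_zero.mp hx).resolve_left ha
  · rw [Submodule.coe_smul, mul_smul_comm, hint, smul_zero]

namespace TwistedForm

variable {k : Type u} [Field k] {X : Scheme.{u}} [X.Over (Spec (.of k))]

theorem exists_affineOpen_image_eq_span {L : X.Modules} (ω : TwistedForm k L)
    (hL : IsLineBundle L) (x : X) :
    ∃ (V : X.affineOpens) (t : Γ(L, V.1)), x ∈ V.1 ∧
      ω.image V = Submodule.span Γ(X, V.1) {ω.app V t} := by
  obtain ⟨U, hxU, s, hs⟩ := hL x
  obtain ⟨V, hV, hxV, hVU⟩ := X.isBasis_affineOpens.exists_subset_of_mem_open hxU U.isOpen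
  obtain ⟨V, hV', rfl⟩ := hV
  refine ⟨⟨V, hV'⟩, resL L hVU s, hxV, ?_⟩
  apply le_antisymm
  · rintro _ ⟨t, rfl⟩
    obtain ⟨r, rfl⟩ := (hs V hVU).2 t
    exact Submodule.mem_span_singleton.mpr ⟨r, (map_smul _ _ _).symm⟩
  · rw [Submodule.span_singleton_le_iff_mem]
    exact ⟨_, rfl⟩

end TwistedForm
end Foliation

theorem mainTheorem4 {k : Type u} [Field k] [CharZero k] {X : Scheme.{u}}
    [X.Over (Spec (CommRingCat.of k))] [IsIntegral X] [Smooth (X ↘ Spec (CommRingCat.of k))]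
    (hX : Foliation.IsProjectiveOver k X) (L : X.Modules) (ω : Foliation.TwistedForm k L)
    (hω : ω.IsFoliation)
    (hJ : ∀ U : X.affineOpens, ((ω.singularIdealSheaf hω.isLineBundle).ideal U).IsRadical) :
    (ω.persistentIdealSheaf hω.isLineBundle).radical =
      (ω.kupkaIdealSheaf hω.isLineBundle).radical := by
  choose V t hxV hV using ω.exists_affineOpen_image_eq_span hω.isLineBundle
  -- The ideal sheaves themselves coincide, which is checked on an affine cover trivialising `L`.
  congr 1
  refine Scheme.IdealSheafData.ext_of_iSup_eq_top V ?_ fun x => ?_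
  · exact eq_top_iff.mpr fun x _ => TopologicalSpace.Opens.mem_iSup.mpr ⟨x, hxV x⟩
  have : Nonempty (V x).1 := ⟨⟨x, hxV x⟩⟩
  have : Algebra.Smooth k Γ(X, (V x).1) := Foliation.TwistedForm.smooth_sections (V x)
  have htf := hω.torsionFree (V x)
  have hJx : (Foliation.singularIdeal (ω.image (V x))).IsRadical := hJ (V x)
  change Foliation.persistentIdeal (ω.image (V x)) = Foliation.kupkaIdeal (ω.image (V x))
  rw [hV] at htf hJx ⊢
  exact Foliation.persistentIdeal_eq_kupkaIdeal htf (hω.integrable (V x) (t x)) hJx
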